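/- **Setting.** Let $(X,\mathcal A)$ be a ringed space, i.e. a topological space $X$ with a sheaf $\mathcal A$ of (not necessarily commutative) rings; for an open set $U\subset X$ let $\mathsf{Mod}\,\mathcal A|_U$ be the abelian category of sheaves of left $\mathcal A|_U$-modules and $\mathsf D(\mathsf{Mod}\,\mathcal A|_U)$ its derived category. Restriction to an open subset $V\subset U$ is denoted by $M\mapsto M|_V$. A *thick abelian substack* $\mathsf C$ of $\mathsf{Mod}\,\mathcal A$ consists of a full subcategory $\mathsf C(U)\subset\mathsf{Mod}\,\mathcal A|_U$ for every open $U\subset X$, which contains a zero object and is closed under kernels, cokernels and extensions in $\mathsf{Mod}\,\mathcal A|_U$, such that: (a) if $V\subset U$ are open and $M\in\mathsf C(U)$, then $M|_V\in\mathsf C(V)$; (b) for every open covering $U=\bigcup_i V_i$, objects $M_i\in\mathsf C(V_i)$ and isomorphisms $\phi_{i,j}:M_i|_{V_i\cap V_j}\to M_j|_{V_i\cap V_j}$ with $\phi_{i,k}=\phi_{j,k}\circ\phi_{i,j}$ on triple intersections, there are $M\in\mathsf C(U)$ and isomorphisms $\phi_i:M|_{V_i}\to M_i$ with $\phi_{i,j}\circ\phi_i=\phi_j$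 on $V_i\cap V_j$; (c) for $M,N\in\mathsf C(U)$, every open covering $U=\bigcup_i V_i$ and morphisms $\psi_i:M|_{V_i}\to N|_{V_i}$ that agree on the intersections $V_i\cap V_j$, there is a unique $\psi:M\to N$ with $\psi|_{V_i}=\psi_i$ for all $i$. Fix such a $\mathsf C$ and a basis $\mathfrak B$ of the topology of $X$. Let $\mathsf D^{b}_{c}(\mathsf{Mod}\,\mathcal A|_U)\subset\mathsf D(\mathsf{Mod}\,\mathcal A|_U)$ be the full triangulated subcategory of the bounded complexes $M$ with $\mathrm H^iM\in\mathsf C(U)$ for all $i$. A *t-structure* on a triangulated category $\mathsf D$ is a pair of full subcategories $(\mathsf D^{\le0},\mathsf D^{\ge0})$, closed under isomorphisms, such that, with $\mathsf D^{\le n}=\mathsf D^{\le0}[-n]$ and $\mathsf D^{\ge n}=\mathsf D^{\ge0}[-n]$: (i) $\mathsf D^{\le-1}\subset\mathsf D^{\le0}$ and $\mathsf D^{\ge1}\subset\mathsf D^{\ge0}$; (ii) $\mathrm{Hom}(M,N)=0$ for $M\in\mathsf D^{\le0}$, $N\in\mathsf D^{\ge1}$; (iii) every $M\in\mathsf D$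 lies in a distinguished triangle $M'\to M\to M''\to M'[1]$ with $M'\in\mathsf D^{\le0}$, $M''\in\mathsf D^{\ge1}$. A *local collection of t-structures* is a t-structure $\bigl({}^p\mathsf D^{b}_{c}(\mathsf{Mod}\,\mathcal A|_U)^{\le0},{}^p\mathsf D^{b}_{c}(\mathsf{Mod}\,\mathcal A|_U)^{\ge0}\bigr)$ on $\mathsf D^{b}_{c}(\mathsf{Mod}\,\mathcal A|_U)$ for every $U\in\mathfrak B$, such that for every $U\in\mathfrak B$, every covering $U=\bigcup_iU_i$ with all $U_i\in\mathfrak B$, every $M\in\mathsf D^{b}_{c}(\mathsf{Mod}\,\mathcal A|_U)$ and each of the two choices $\star\in\{\le0,\ge0\}$, $$M\in{}^p\mathsf D^{b}_{c}(\mathsf{Mod}\,\mathcal A|_U)^{\star}\iff M|_{U_i}\in{}^p\mathsf D^{b}_{c}(\mathsf{Mod}\,\mathcal A|_{U_i})^{\star}\text{ for all }i.$$ **Theorem 4.10.** Let a local collection of t-structures on $(X,\mathcal A)$ be given and assume that $X$ is a noetherian topological space. For $\star\in\{\le0,\ge0\}$ let ${}^p\mathsf D^{b}_{c}(\mathsf{Mod}\,\mathcal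 A)^{\star}$ be the full subcategory of those $M\in\mathsf D^{b}_{c}(\mathsf{Mod}\,\mathcal A)$ such that $M|_U\in{}^p\mathsf D^{b}_{c}(\mathsf{Mod}\,\mathcal A|_U)^{\star}$ for every $U\in\mathfrak B$. Then the pair $$\bigl({}^p\mathsf D^{b}_{c}(\mathsf{Mod}\,\mathcal A)^{\le0},\ {}^p\mathsf D^{b}_{c}(\mathsf{Mod}\,\mathcal A)^{\ge0}\bigr)$$ is a t-structure on $\mathsf D^{b}_{c}(\mathsf{Mod}\,\mathcal A)$. -/

import Mathlib

open CategoryTheory Limits TopologicalSpace Triangulated Pretriangulated ZeroObject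

universe u v v' w w' w''

namespace GluingTStructures

section Abstract

variable {E : Type w} [Category.{v} E] [Abelian E]

/-- A thick abelian subcategory of an abelian category (given by the predicate `P` on objects):
a full subcategory containing a zero object and closed under kernels, cokernels and extensions
(all taken in the ambient category). It is automatically closed under isomorphisms. -/
class IsThickAbelian (P : ObjectProperty E) : Prop extends P.ContainsZero,
    P.IsClosedUnderKernels, P.IsClosedUnderCokernels, P.IsClosedUnderExtensions

lemma IsThickAbelian.of_iso (P : ObjectProperty E) [IsThickAbelian P] {M N : E} (e : M ≅ N)
    (hM : P M) : P N := by
  obtain ⟨Z, hZ, hPZ⟩ := P.exists_prop_of_containsZero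
  have : Mono e.hom := inferInstance
  let S : ShortComplex E := ShortComplex.mk e.hom (0 : N ⟶ Z) (by simp)
  have hS : S.ShortExact :=
    { exact := (S.exact_iff_epi rfl).2 (by dsimp [S]; infer_instance)
      mono_f := by dsimp [S]; infer_instance
      epi_g := ⟨fun _ _ _ => hZ.eq_of_src _ _⟩ }
  exact P.prop_X₂_of_shortExact hS hM hPZ

instance (P : ObjectProperty E) [IsThickAbelian P] : P.IsClosedUnderIsomorphisms :=
  ⟨fun e h => IsThickAbelian.of_iso P e h⟩

lemma IsThickAbelian.of_exact (P : ObjectProperty E) [IsThickAbelian P]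
    {M₁ M₂ M₃ M₄ M₅ : E} (f : M₁ ⟶ M₂) (g : M₂ ⟶ M₃) (h : M₃ ⟶ M₄) (k : M₄ ⟶ M₅)
    (w₁ : f ≫ g = 0) (w₂ : g ≫ h = 0) (w₃ : h ≫ k = 0)
    (e₁ : (ShortComplex.mk f g w₁).Exact) (e₂ : (ShortComplex.mk g h w₂).Exact)
    (e₃ : (ShortComplex.mk h k w₃).Exact)
    (h₁ : P M₁) (h₂ : P M₂) (h₄ : P M₄) (h₅ : P M₅) : P M₃ := by
  let S : ShortComplex E := ShortComplex.mk (cokernel.desc f g w₁) (kernel.lift k h w₃) (by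
    rw [← cancel_epi (cokernel.π f), ← cancel_mono (kernel.ι k)]; simpa using w₂)
  have : Mono S.f := e₁.mono_cokernelDesc
  have : Epi S.g := e₃.epi_kernelLift
  have hS : S.Exact := by
    let φ : ShortComplex.mk g h w₂ ⟶ ShortComplex.mk (cokernel.desc f g w₁) h (by
        rw [← cancel_epi (cokernel.π f)]; simpa using w₂) :=
      { τ₁ := cokernel.π f, τ₂ := 𝟙 _, τ₃ := 𝟙 _ }
    have h₁ := (ShortComplex.exact_iff_of_epi_of_isIso_of_mono φ).1 e₂
    let ψ : S ⟶ ShortComplex.mk (cokernel.desc f g w₁) h (by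
        rw [← cancel_epi (cokernel.π f)]; simpa using w₂) :=
      { τ₁ := 𝟙 _, τ₂ := 𝟙 _, τ₃ := kernel.ι k }
    exact (ShortComplex.exact_iff_of_epi_of_isIso_of_mono ψ).2 h₁
  exact P.prop_X₂_of_shortExact (S := S) ⟨hS⟩ (P.prop_cokernel f h₁ h₂) (P.prop_kernel k h₄ h₅)

instance IsThickAbelian.inverseImage {E' : Type w'} [Category.{v'} E'] [Abelian E']
    (F : E' ⥤ E) [F.Additive] [PreservesFiniteLimits F] [PreservesFiniteColimits F]
    (P : ObjectProperty E) [IsThickAbelian P] : IsThickAbelian (P.inverseImage F) where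
  exists_zero := ⟨0, isZero_zero _, by
    obtain ⟨Z, hZ, hPZ⟩ := P.exists_prop_of_containsZero
    exact P.prop_of_iso (hZ.iso (F.map_isZero (isZero_zero _))) hPZ⟩
  kernels_le := by
    rintro _ ⟨f, k, hk, hf⟩
    exact P.prop_of_iso ((kernelIsKernel (F.map f)).conePointUniqueUpToIso
      (KernelFork.mapIsLimit k hk F)) (P.prop_kernel (F.map f) hf.1 hf.2)
  cokernels_le := by
    rintro _ ⟨f, k, hk, hf⟩
    exact P.prop_of_iso ((cokernelIsCokernel (F.map f)).coconePointUniqueUpToIso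
      (CokernelCofork.mapIsColimit k hk F)) (P.prop_cokernel (F.map f) hf.1 hf.2)

variable [HasDerivedCategory.{w'} E]

/-- The objects of the derived category all of whose cohomology objects satisfy `P`. -/
def cohomologyIn (P : ObjectProperty E) : ObjectProperty (DerivedCategory E) :=
  fun M => ∀ n : ℤ, P ((DerivedCategory.homologyFunctor E n).obj M)

/-- The bounded objects of the derived category (bounded for the standard t-structure) all of
whose cohomology objects satisfy `P`. -/
def boundedCohomologyIn (P : ObjectProperty E) : ObjectProperty (DerivedCategory E) :=
  (DerivedCategory.TStructure.t (C := E)).bounded ⊓ cohomologyIn P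

instance (P : ObjectProperty E) [IsThickAbelian P] :
    (cohomologyIn P).IsClosedUnderIsomorphisms :=
  ⟨fun e h n => P.prop_of_iso ((DerivedCategory.homologyFunctor E n).mapIso e) (h n)⟩

instance (P : ObjectProperty E) [IsThickAbelian P] : (cohomologyIn P).IsTriangulated where
  exists_zero := ⟨0, isZero_zero _, fun n => by
    obtain ⟨Z, hZ, hPZ⟩ := P.exists_prop_of_containsZero
    exact P.prop_of_iso (hZ.iso
      ((DerivedCategory.homologyFunctor E n).map_isZero (isZero_zero _))) hPZ⟩
  isStableUnderShiftBy a := ⟨fun M hM n =>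
    P.prop_of_iso ((((DerivedCategory.homologyFunctor E 0).shiftIso a n (a + n) rfl).app M).symm)
      (hM (a + n))⟩
  toIsTriangulatedClosed₂ := .mk' (fun T hT h₁ h₃ n =>
    IsThickAbelian.of_exact P
      (DerivedCategory.HomologySequence.δ T (n - 1) n) _ _
      (DerivedCategory.HomologySequence.δ T n (n + 1)) _ _ _
      (DerivedCategory.HomologySequence.exact₁ T hT (n - 1) n)
      (DerivedCategory.HomologySequence.exact₂ T hT n)
      (DerivedCategory.HomologySequence.exact₃ T hT n (n + 1))
      (h₃ _) (h₁ _) (h₃ _) (h₁ _))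

instance (P : ObjectProperty E) [IsThickAbelian P] : (boundedCohomologyIn P).IsTriangulated := by
  dsimp [boundedCohomologyIn]
  infer_instance

section Functoriality

variable {E' : Type*} [Category* E'] [Abelian E'] [HasDerivedCategory.{w''} E']
  (F : E ⥤ E') [F.Additive] [PreservesFiniteLimits F] [PreservesFiniteColimits F]

/-- An exact functor commutes with the cohomology of objects of the derived category. -/
lemma nonempty_homology_mapDerivedCategory_iso (n : ℤ) (M : DerivedCategory E) :
    Nonempty ((DerivedCategory.homologyFunctor E' n).obj (F.mapDerivedCategory.obj M) ≅
      F.obj ((DerivedCategory.homologyFunctor E n).obj M)) := by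
  let K := DerivedCategory.Q.objPreimage M
  let e : DerivedCategory.Q.obj K ≅ M := DerivedCategory.Q.objObjPreimageIso M
  exact ⟨(DerivedCategory.homologyFunctor E' n).mapIso
      (F.mapDerivedCategory.mapIso e.symm ≪≫ F.mapDerivedCategoryFactors.app K) ≪≫
    (DerivedCategory.homologyFunctorFactors E' n).app _ ≪≫
    (K.sc n).mapHomologyIso F ≪≫
    F.mapIso ((DerivedCategory.homologyFunctorFactors E n).symm.app K ≪≫
      (DerivedCategory.homologyFunctor E n).mapIso e)⟩

lemma boundedCohomologyIn_mapDerivedCategory {P : ObjectProperty E} {Q : ObjectProperty E'}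
    [IsThickAbelian Q] (hPQ : ∀ M, P M → Q (F.obj M)) (M : DerivedCategory E)
    (hM : boundedCohomologyIn P M) : boundedCohomologyIn Q (F.mapDerivedCategory.obj M) := by
  obtain ⟨⟨⟨a, ha⟩, ⟨b, hb⟩⟩, hc⟩ := hM
  have ha' := (DerivedCategory.isGE_iff M a).1 ha
  have hb' := (DerivedCategory.isLE_iff M b).1 hb
  refine ⟨⟨⟨a, (DerivedCategory.isGE_iff _ a).2 fun i hi => ?_⟩,
    ⟨b, (DerivedCategory.isLE_iff _ b).2 fun i hi => ?_⟩⟩, fun n => ?_⟩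
  · obtain ⟨e⟩ := nonempty_homology_mapDerivedCategory_iso F i M
    exact (F.map_isZero (ha' i hi)).of_iso e
  · obtain ⟨e⟩ := nonempty_homology_mapDerivedCategory_iso F i M
    exact (F.map_isZero (hb' i hi)).of_iso e
  · obtain ⟨e⟩ := nonempty_homology_mapDerivedCategory_iso F n M
    exact Q.prop_of_iso e.symm (hPQ _ (hc n))

/-- The functor between categories of bounded complexes with restricted cohomology that is
induced by an exact functor `F`. -/
noncomputable def mapBounded {P : ObjectProperty E} {Q : ObjectProperty E'}
    [IsThickAbelian Q] (hPQ : ∀ M, P M → Q (F.obj M)) :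
    (boundedCohomologyIn P).FullSubcategory ⥤ (boundedCohomologyIn Q).FullSubcategory :=
  ObjectProperty.lift _ ((boundedCohomologyIn P).ι ⋙ F.mapDerivedCategory)
    (fun M => boundedCohomologyIn_mapDerivedCategory F hPQ M.obj M.property)

end Functoriality

end Abstract

section RingedSpace

variable {X : Type u} [TopologicalSpace X]

/-- `Mod A`: the category of sheaves of left modules over a sheaf of (not necessarily
commutative) rings `A` on `X`. -/
abbrev Mod (A : Sheaf (Opens.grothendieckTopology X) RingCat.{u}) := SheafOfModules.{u} A

/-- `Mod A|_U`: the category of sheaves of left modules over the restriction of `A` to the open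
subset `U`. The site `Over U` of open subsets `V ≤ U` of `X` is the site of open subsets of the
space `U`. -/
abbrev ModOn (A : Sheaf (Opens.grothendieckTopology X) RingCat.{u}) (U : Opens X) :=
  SheafOfModules.{u} (A.over U)

variable (A : Sheaf (Opens.grothendieckTopology X) RingCat.{u})

noncomputable instance : HasDerivedCategory.{u + 1} (Mod A) := HasDerivedCategory.standard _

noncomputable instance (U : Opens X) : HasDerivedCategory.{u + 1} (ModOn A U) :=
  HasDerivedCategory.standard _

/-- Restriction of sheaves of modules from `X` to the open subset `U`. -/
noncomputable abbrev resTo (U : Opens X) : Mod A ⥤ ModOn A U :=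
  SheafOfModules.overFunctor A U

/-- Restriction of sheaves of modules from the open subset `U` to the open subset `V ≤ U`. -/
noncomputable abbrev res {V U : Opens X} (h : V ≤ U) : ModOn A U ⥤ ModOn A V :=
  SheafOfModules.overMap A (homOfLE h)

instance (U : Opens X) : (resTo A U).IsRightAdjoint := by
  have : (PresheafOfModules.pushforward.{u} (R := A.obj) (F := Over.forget U)
      (𝟙 (A.over U) : A.over U ⟶ A.over U).hom).IsRightAdjoint :=
    PresheafOfModules.instIsRightAdjointPushforward _
  exact SheafOfModules.instIsRightAdjointPushforward _

instance (U : Opens X) : (resTo A U).IsLeftAdjoint :=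
  (SheafOfModules.overPushforwardOverAdj (R := A) U).isLeftAdjoint

instance {V U : Opens X} (h : V ≤ U) : (res A h).IsRightAdjoint := by
  have : (PresheafOfModules.pushforward.{u}
      (A.pushforwardOverMapIso (homOfLE h)).inv.hom).IsRightAdjoint :=
    PresheafOfModules.instIsRightAdjointPushforward _
  exact SheafOfModules.instIsRightAdjointPushforward _

instance (U : Opens X) : (resTo A U).Additive where
  map_add := rfl

instance {V U : Opens X} (h : V ≤ U) : (res A h).Additive where
  map_add := rfl

instance {V U : Opens X} (h : V ≤ U) : PreservesFiniteLimits (res A h) := inferInstance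
instance {V U : Opens X} (h : V ≤ U) : PreservesFiniteColimits (res A h) := inferInstance
instance (U : Opens X) : PreservesFiniteLimits (resTo A U) := inferInstance
instance (U : Opens X) : PreservesFiniteColimits (resTo A U) := inferInstance

/-- The canonical identification `(M|_V)|_W = M|_W` for open subsets `W ≤ V ≤ U`. -/
noncomputable def resComp {W V U : Opens X} (h : W ≤ V) (h' : V ≤ U) :
    res A h' ⋙ res A h ≅ res A (h.trans h') :=
  NatIso.ofComponents fun M ↦ (SheafOfModules.fullyFaithfulForget _).preimageIso <|
    PresheafOfModules.isoMk (fun _ ↦ Iso.refl _)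

/-- Given a morphism `f : M|_W ⟶ N|_W`, with `M` on `V` and `N` on `V'`, its restriction
`f|_{W'} : M|_{W'} ⟶ N|_{W'}` to an open subset `W' ≤ W`. -/
noncomputable def resHom {W' W V V' : Opens X} (k : W' ≤ W) (h : W ≤ V) (h' : W ≤ V')
    {M : ModOn A V} {N : ModOn A V'} (f : (res A h).obj M ⟶ (res A h').obj N) :
    (res A (k.trans h)).obj M ⟶ (res A (k.trans h')).obj N :=
  (resComp A k h).inv.app M ≫ (res A k).map f ≫ (resComp A k h').hom.app N

/-- Given a morphism `f : M|_W ⟶ N`, with `M` on `V` and `N` on `W`, its restriction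
`f|_{W'} : M|_{W'} ⟶ N|_{W'}` to an open subset `W' ≤ W`. -/
noncomputable def resHom' {W' W V : Opens X} (k : W' ≤ W) (h : W ≤ V)
    {M : ModOn A V} {N : ModOn A W} (f : (res A h).obj M ⟶ N) :
    (res A (k.trans h)).obj M ⟶ (res A k).obj N :=
  (resComp A k h).inv.app M ≫ (res A k).map f

/-- A thick abelian substack `C` of the stack `U ↦ Mod A|_U`: a thick abelian subcategory `C(U)`
of `Mod A|_U` for every open subset `U`, stable under restriction and satisfying descent
for objects and for morphisms. -/
structure ThickAbelianSubstack where
  /-- the objects of the full subcategory `C(U)` -/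
  mem (U : Opens X) : ObjectProperty (ModOn A U)
  isThickAbelian (U : Opens X) : IsThickAbelian (mem U)
  mem_res {V U : Opens X} (h : V ≤ U) (M : ModOn A U) (hM : mem U M) : mem V ((res A h).obj M)
  /-- Descent for objects: gluing along isomorphisms `φ i j : M i|_{V i ⊓ V j} ≅ M j|_{V i ⊓ V j}`
  satisfying the cocycle condition on triple intersections. -/
  descent_obj {U : Opens X} {ι : Type u} (V : ι → Opens X) (hVU : ∀ i, V i ≤ U)
    (hcov : U = ⨆ i, V i) (M : ∀ i, ModOn A (V i)) (hM : ∀ i, mem (V i) (M i))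
    (φ : ∀ i j, (res A (inf_le_left : V i ⊓ V j ≤ V i)).obj (M i) ≅
      (res A (inf_le_right : V i ⊓ V j ≤ V j)).obj (M j))
    (cocycle : ∀ i j k,
      resHom A (le_inf (inf_le_left.trans inf_le_left) inf_le_right :
        (V i ⊓ V j) ⊓ V k ≤ V i ⊓ V k) inf_le_left inf_le_right (φ i k).hom =
      resHom A (inf_le_left : (V i ⊓ V j) ⊓ V k ≤ V i ⊓ V j)
        inf_le_left inf_le_right (φ i j).hom ≫
      resHom A (le_inf (inf_le_left.trans inf_le_right) inf_le_right :
        (V i ⊓ V j) ⊓ V k ≤ V j ⊓ V k) inf_le_left inf_le_right (φ j k).hom) :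
    ∃ (N : ModOn A U) (_ : mem U N) (ψ : ∀ i, (res A (hVU i)).obj N ≅ M i),
      ∀ i j, resHom' A inf_le_left (hVU i) (ψ i).hom ≫ (φ i j).hom =
        resHom' A inf_le_right (hVU j) (ψ j).hom
  /-- Descent for morphisms. -/
  descent_hom {U : Opens X} (M N : ModOn A U) (hM : mem U M) (hN : mem U N)
    {ι : Type u} (V : ι → Opens X) (hVU : ∀ i, V i ≤ U) (hcov : U = ⨆ i, V i)
    (ψ : ∀ i, (res A (hVU i)).obj M ⟶ (res A (hVU i)).obj N)
    (compat : ∀ i j, resHom A (inf_le_left : V i ⊓ V j ≤ V i) (hVU i) (hVU i) (ψ i) =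
      resHom A (inf_le_right : V i ⊓ V j ≤ V j) (hVU j) (hVU j) (ψ j)) :
    ∃! f : M ⟶ N, ∀ i, (res A (hVU i)).map f = ψ i

attribute [instance] ThickAbelianSubstack.isThickAbelian

namespace ThickAbelianSubstack

variable {A} (C : ThickAbelianSubstack A)

/-- The subcategory `C(X)` of `Mod A`. -/
def global : ObjectProperty (Mod A) := (C.mem ⊤).inverseImage (resTo A ⊤)

instance : IsThickAbelian C.global := by
  dsimp [global]
  infer_instance

lemma mem_resTo (U : Opens X) (M : Mod A) (hM : C.global M) : C.mem U ((resTo A U).obj M) :=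
  (C.mem U).prop_of_iso ((SheafOfModules.overFunctorMap A (homOfLE (le_top : U ≤ ⊤))).app M)
    (C.mem_res le_top _ hM)

/-- `D^b_c(Mod A)`: the bounded complexes `M` on `X` with `H^i M ∈ C(X)` for all `i`. -/
abbrev Dbc := (boundedCohomologyIn C.global).FullSubcategory

/-- `D^b_c(Mod A|_U)`: the bounded complexes `M` on `U` with `H^i M ∈ C(U)` for all `i`. -/
abbrev DbcOn (U : Opens X) := (boundedCohomologyIn (C.mem U)).FullSubcategory

/-- Restriction `D^b_c(Mod A) ⥤ D^b_c(Mod A|_U)`. -/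
noncomputable def dresTo (U : Opens X) : C.Dbc ⥤ C.DbcOn U :=
  mapBounded (resTo A U) (C.mem_resTo U)

/-- Restriction `D^b_c(Mod A|_U) ⥤ D^b_c(Mod A|_V)` for `V ≤ U`. -/
noncomputable def dres {V U : Opens X} (h : V ≤ U) : C.DbcOn U ⥤ C.DbcOn V :=
  mapBounded (res A h) (C.mem_res h)

/-- A local collection of t-structures, indexed by the members `U` of a set `B` of open subsets
of `X`: a t-structure on each `D^b_c(Mod A|_U)` such that belonging to the subcategory of objects
`≤ 0`, or `≥ 0`, can be tested on any covering of `U` by members of `B`. -/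
structure LocalTStructures (B : Set (Opens X)) where
  /-- the t-structure on `D^b_c(Mod A|_U)` -/
  t (U : Opens X) (hU : U ∈ B) : TStructure (C.DbcOn U)
  le_local (U : Opens X) (hU : U ∈ B) {ι : Type u} (V : ι → Opens X) (hV : ∀ i, V i ∈ B)
    (hVU : ∀ i, V i ≤ U) (hcov : U = ⨆ i, V i) (M : C.DbcOn U) :
    (t U hU).le 0 M ↔ ∀ i, (t (V i) (hV i)).le 0 ((C.dres (hVU i)).obj M)
  ge_local (U : Opens X) (hU : U ∈ B) {ι : Type u} (V : ι → Opens X) (hV : ∀ i, V i ∈ B)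
    (hVU : ∀ i, V i ≤ U) (hcov : U = ⨆ i, V i) (M : C.DbcOn U) :
    (t U hU).ge 0 M ↔ ∀ i, (t (V i) (hV i)).ge 0 ((C.dres (hVU i)).obj M)

namespace LocalTStructures

variable {C} {B : Set (Opens X)} (T : C.LocalTStructures B)

/-- The objects of `D^b_c(Mod A)` whose restriction to every `U ∈ B` is `≤ 0`. -/
def gluedLE : ObjectProperty C.Dbc :=
  fun M => ∀ (U : Opens X) (hU : U ∈ B), (T.t U hU).le 0 ((C.dresTo U).obj M)

/-- The objects of `D^b_c(Mod A)` whose restriction to every `U ∈ B` is `≥ 0`. -/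
def gluedGE : ObjectProperty C.Dbc :=
  fun M => ∀ (U : Opens X) (hU : U ∈ B), (T.t U hU).ge 0 ((C.dresTo U).obj M)

end LocalTStructures

end ThickAbelianSubstack

end RingedSpace

end GluingTStructures

/-!
Gluing of t-structures on a noetherian ringed space.

Let `j_!` be the left adjoint of the restriction `M ↦ M|_U` to an open subset `U`. Every section of
`j_! N` vanishes near each point outside `U` (`supportedIn_extZero`), which shows that
`j_! (M|_U) ⟶ M` is a monomorphism and that `j_!` is exact. Hence `j_!` and the restriction induce
adjoint functors between the derived categories, the unit of this adjunction being an isomorphism,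
without resolutions or derived functors. Write `M_U` for `j_! (M|_U)` (`cutoff`). Morphisms
`M|_U ⟶ N|_U` are the same as morphisms `M_U ⟶ N`, and a morphism that restricts to an isomorphism
on `U` becomes invertible for morphisms out of `M_U` (`cutoff_comp_bijective`). This allows one to
work in the derived category of the whole space all the time, where weak pushouts of
`M_U ⟵ M_{U ⊓ V} ⟶ N_V`, that is, cones, glue `M` on `U` and `N` on `V` along a morphism
`M_{U ⊓ V} ⟶ N` that is an isomorphism on `U ⊓ V` (`exists_glued`).

*Vanishing of morphisms.* Let `M` be locally `≤ 0` and `N` locally `≥ 1` on an open subset `W`.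
Then `Hom(M[i]|_V, N|_V) = 0` for all `i ≥ 0` and all open `V ≤ W`
(`homVanishes_shift_of_restrictsToOn`). As `M` and `N` are bounded this holds for large `i`, so one
descends on `i`. For fixed `i` it holds for `V` in the basis by the axioms of a t-structure, and it
passes from `U` and `V` to `U ⊔ V` by a Mayer-Vietoris argument that needs the vanishing
for `i + 1` on `U ⊓ V` (`HomVanishes.sup`). On a noetherian space each open subset is a finite
union of members of the basis, so this reaches all `V`.

*Existence of truncations.* By the same induction on open subsets, every `M` is part of a
distinguished triangle `M' ⟶ M ⟶ Y ⟶ M'[1]` on `X` with `M'` locally `≤ 0` and `Y` locally `≥ 1`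
on `W` (`hasTruncationOn`). For `W` in the basis one takes `j_!` of the truncation on `W`. For
`W₁ ⊔ W₂`, the vanishing theorem on `W₁ ⊓ W₂` provides a comparison of the two truncations
that is an isomorphism there; the weak pushout along it maps to `M` and restricts to the given
truncations on `W₁` and on `W₂` (`exists_glued_triangle`). The cone of that map is then the
truncation `≥ 1`. Finally, the cohomology of `M'` lies in the substack because this is a local
property, by descent for objects (`ThickAbelianSubstack.mem_of_cover`).
-/

namespace GluingTStructures

/-! ### Direct image and extension by zero -/

section
variable {X : Type u} [TopologicalSpace X] (A : Sheaf (Opens.grothendieckTopology X) RingCat.{u})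

/-- The direct image functor `j_*` along the inclusion `j` of the open subset `U`. -/
noncomputable abbrev directImage (U : Opens X) : ModOn A U ⥤ Mod A :=
  SheafOfModules.pushforward (SheafOfModules.pushforwardOver (R := A) U)

/-- The adjunction between the restriction to `U` and the direct image from `U`. -/
noncomputable abbrev directImageAdj (U : Opens X) : resTo A U ⊣ directImage A U :=
  SheafOfModules.overPushforwardOverAdj (R := A) U

instance (U : Opens X) (W : Over U) : IsIso ((Over.forgetAdjStar U).unit.app W) := by
  refine ⟨Over.homMk (Limits.prod.snd) (Subsingleton.elim _ _), ?_, ?_⟩ <;>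
  · ext
    exact Subsingleton.elim _ _

lemma isIso_of_bijective_sections {C : Type*} [Category* C] {J : GrothendieckTopology C}
    {R : Sheaf J RingCat.{u}} {M N : SheafOfModules.{u} R} (f : M ⟶ N)
    (h : ∀ W, Function.Bijective (f.val.app W)) : IsIso f := by
  have : IsIso ((SheafOfModules.forget R).map f) := by
    have : IsIso ((PresheafOfModules.toPresheaf R.obj).map ((SheafOfModules.forget R).map f)) := by
      rw [NatTrans.isIso_iff_isIso_app]
      intro W
      rw [ConcreteCategory.isIso_iff_bijective]
      exact h W
    exact isIso_of_reflects_iso _ (PresheafOfModules.toPresheaf R.obj)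
  exact isIso_of_reflects_iso _ (SheafOfModules.forget R)

instance (U : Opens X) : IsIso (directImageAdj A U).counit := by
  rw [NatTrans.isIso_iff_isIso_app]
  intro N
  apply isIso_of_bijective_sections
  intro W
  exact (ConcreteCategory.isIso_iff_bijective
    (N.val.presheaf.map ((Over.forgetAdjStar U).unit.app W.unop).op)).1 inferInstance

instance (U : Opens X) : (directImage A U).Full :=
  (directImageAdj A U).fullyFaithfulROfIsIsoCounit.full
instance (U : Opens X) : (directImage A U).Faithful :=
  (directImageAdj A U).fullyFaithfulROfIsIsoCounit.faithful

/-- The extension by zero `j_!`, the left adjoint of the restriction to the open subset `U`. -/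
noncomputable def extZero (U : Opens X) : ModOn A U ⥤ Mod A := (resTo A U).leftAdjoint

/-- `j_!` is left adjoint to the restriction. -/
noncomputable def extZeroAdj (U : Opens X) : extZero A U ⊣ resTo A U :=
  Adjunction.ofIsRightAdjoint _

/-- The left adjoint of a functor whose right adjoint is fully faithful is fully faithful. -/
noncomputable def extZeroFullyFaithful (U : Opens X) : (extZero A U).FullyFaithful :=
  (Adjunction.Triple.mk (extZeroAdj A U) (directImageAdj A U)).fullyFaithfulEquiv.symm
    (Functor.FullyFaithful.ofFullyFaithful _)

instance (U : Opens X) : (extZero A U).Full := (extZeroFullyFaithful A U).full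
instance (U : Opens X) : (extZero A U).Faithful := (extZeroFullyFaithful A U).faithful
instance (U : Opens X) : (extZero A U).IsLeftAdjoint := (extZeroAdj A U).isLeftAdjoint
instance (U : Opens X) : (extZero A U).Additive := (extZeroAdj A U).left_adjoint_additive
instance (U : Opens X) : IsIso (extZeroAdj A U).unit := inferInstance
instance (U : Opens X) : PreservesFiniteColimits (extZero A U) :=
  have := (extZeroAdj A U).leftAdjoint_preservesColimits
  PreservesColimits.preservesFiniteColimits _
end

/-! ### Sections supported in an open subset -/

section
open Opposite
variable {X : Type u} [TopologicalSpace X] {A : Sheaf (Opens.grothendieckTopology X) RingCat.{u}}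

/-- The sheaf of abelian groups on the space `X` underlying a sheaf of modules, to which the gluing
lemmas for sheaves on spaces apply. -/
noncomputable def abSheaf (P : Mod A) : TopCat.Sheaf Ab.{u} (TopCat.of X) :=
  ⟨P.val.presheaf, P.isSheaf⟩

/-- The section `s` over `W` vanishes near each point of `W` outside `U`. That is, the
support of `s`, a closed subset of `W`, is contained in `U`. -/
def SupportedIn (U : Opens X) {P : Mod A} {W : Opens X} (s : P.val.presheaf.obj (op W)) : Prop :=
  ∀ x ∈ W, x ∉ U → ∃ (V : Opens X) (hV : V ≤ W), x ∈ V ∧ P.val.presheaf.map (homOfLE hV).op s = 0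

lemma restrict_restrict (P : Mod A) {W V V' : Opens X} (i : V ⟶ W) (j : V' ⟶ V) (k : V' ⟶ W)
    (s : P.val.presheaf.obj (op W)) :
    P.val.presheaf.map j.op (P.val.presheaf.map i.op s) = P.val.presheaf.map k.op s := by
  rw [← ConcreteCategory.comp_apply, ← Functor.map_comp]; rfl

lemma SupportedIn.map {U : Opens X} {P : Mod A} {W V : Opens X} (f : V ⟶ W)
    {s : P.val.presheaf.obj (op W)} (hs : SupportedIn U s) :
    SupportedIn U (P.val.presheaf.map f.op s) := by
  intro x hx hxU
  obtain ⟨V', hV', hx', h0⟩ := hs x (f.le hx) hxU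
  refine ⟨V' ⊓ V, inf_le_right, ⟨hx', hx⟩, ?_⟩
  rw [restrict_restrict P _ _ (homOfLE (inf_le_left.trans hV')),
    ← restrict_restrict P (homOfLE hV') (homOfLE inf_le_left), h0, map_zero]

lemma SupportedIn.add {U : Opens X} {P : Mod A} {W : Opens X}
    {s t : P.val.presheaf.obj (op W)} (hs : SupportedIn U s) (ht : SupportedIn U t) :
    SupportedIn U (s + t) := by
  intro x hx hxU
  obtain ⟨V, hV, hxV, h⟩ := hs x hx hxU
  obtain ⟨V', hV', hxV', h'⟩ := ht x hx hxU
  refine ⟨V ⊓ V', inf_le_left.trans hV, ⟨hxV, hxV'⟩, ?_⟩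
  rw [map_add, ← restrict_restrict P (homOfLE hV) (homOfLE inf_le_left), h,
    ← restrict_restrict P (homOfLE hV') (homOfLE inf_le_right), h', map_zero, map_zero, add_zero]

/-- The presheaf of submodules of `P` formed by the sections supported in `U`. -/
def supportedSections (U : Opens X) (P : Mod A) : P.val.Submodule where
  obj W :=
    { carrier := {s | SupportedIn (P := P) (W := W.unop) U s}
      add_mem' := fun hs ht => SupportedIn.add hs ht
      zero_mem' := fun x hx _ => ⟨W.unop, le_rfl, hx, map_zero _⟩
      smul_mem' := by
        intro r s hs x hx hxU
        obtain ⟨V, hV, hxV, h⟩ := hs x hx hxU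
        have h' : P.val.map (homOfLE hV).op s = 0 := h
        refine ⟨V, hV, hxV, (P.val.map_smul (homOfLE hV).op r s).trans ?_⟩
        rw [h', smul_zero]
        rfl }
  map f s hs := SupportedIn.map (P := P) f.unop hs

lemma SupportedIn.of_cover {U : Opens X} {P : Mod A} {ι : Type*} (V : ι → Opens X)
    {s : P.val.presheaf.obj (op (iSup V))}
    (h : ∀ i, SupportedIn U (P.val.presheaf.map (homOfLE (le_iSup V i)).op s)) :
    SupportedIn U s := by
  intro x hx hxU
  obtain ⟨i, hi⟩ := Opens.mem_iSup.1 hx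
  obtain ⟨V', hV', hx', h0⟩ := h i x hi hxU
  exact ⟨V', hV'.trans (le_iSup V i), hx', by
    rwa [restrict_restrict P _ _ (homOfLE (hV'.trans (le_iSup V i)))] at h0⟩

/-- The sections supported in `U` form a sheaf since being supported in `U` is a local condition. -/
lemma isSheaf_supportedSections (U : Opens X) (P : Mod A) :
    TopCat.Presheaf.IsSheaf (X := TopCat.of X)
      (supportedSections U P).toPresheafOfModules.presheaf := by
  rw [TopCat.Presheaf.isSheaf_iff_isSheafUniqueGluing]
  intro ι V sf hsf
  obtain ⟨s, hs, huniq⟩ := (abSheaf P).existsUnique_gluing V (fun i => (sf i).1)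
    (fun i j => congrArg Subtype.val (hsf i j))
  refine ⟨⟨s, SupportedIn.of_cover V fun i => ?_⟩, fun i => Subtype.ext (hs i), fun t ht => ?_⟩
  · have : P.val.presheaf.map (homOfLE (le_iSup V i)).op s = (sf i).1 := hs i
    rw [this]
    exact (sf i).2
  · exact Subtype.ext (huniq _ fun i => congrArg Subtype.val (ht i))

/-- The subsheaf of `P` formed by the sections supported in `U`. -/
noncomputable def supportedSubsheaf (U : Opens X) (P : Mod A) : Mod A :=
  ⟨_, isSheaf_supportedSections U P⟩

/-- The inclusion of the subsheaf of sections supported in `U`. -/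
noncomputable def supportedSubsheafι (U : Opens X) (P : Mod A) : supportedSubsheaf U P ⟶ P :=
  ⟨(supportedSections U P).ι⟩

instance (U : Opens X) (P : Mod A) : IsIso ((resTo A U).map (supportedSubsheafι U P)) := by
  apply isIso_of_bijective_sections
  intro W
  refine ⟨Subtype.val_injective, fun s => ⟨⟨s, ?_⟩, rfl⟩⟩
  intro x hx hxU
  exact (hxU (leOfHom W.unop.hom hx)).elim

end

/-! ### Exactness of the extension by zero -/

section
open Opposite

lemma isZero_iff_sections {C : Type*} [Category* C] {J : GrothendieckTopology C}
    {R : Sheaf J RingCat.{u}} (M : SheafOfModules.{u} R) :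
    IsZero M ↔ ∀ W (s : M.val.presheaf.obj W), s = 0 := by
  rw [IsZero.iff_id_eq_zero]
  constructor
  · intro h W s
    exact congrArg (fun f : M ⟶ M => f.val.app W s) h
  · intro h
    ext W s
    exact h W s

lemma mono_of_injective_sections {C : Type*} [Category* C] {J : GrothendieckTopology C}
    {R : Sheaf J RingCat.{u}} {M N : SheafOfModules.{u} R} (f : M ⟶ N)
    (h : ∀ W, Function.Injective (f.val.app W)) : Mono f := by
  have : Mono ((SheafOfModules.forget R).map f) :=
    PresheafOfModules.mono_of_injective (fun W => h W)
  exact (SheafOfModules.forget R).mono_of_mono_map this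

variable {X : Type u} [TopologicalSpace X] {A : Sheaf (Opens.grothendieckTopology X) RingCat.{u}}

lemma injective_sections_of_mono {M N : Mod A} (f : M ⟶ N) [Mono f] (W) :
    Function.Injective (f.val.app W) := by
  have : Mono ((SheafOfModules.forget A).map f) := inferInstance
  exact PresheafOfModules.injective_of_mono ((SheafOfModules.forget A).map f) W

lemma bijective_sections_of_isIso {M N : Mod A} (f : M ⟶ N) [IsIso f] (W) :
    Function.Bijective (f.val.app W) := by
  rw [← ConcreteCategory.isIso_iff_bijective]
  exact inferInstanceAs (IsIso ((SheafOfModules.evaluation A W).map f))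

instance (U : Opens X) (P : Mod A) : Mono (supportedSubsheafι U P) :=
  mono_of_injective_sections _ fun _ => Subtype.val_injective

/-- Sections of `j_! N` are supported in `U`. The inclusion `i` of the subsheaf of sections
supported in `U` is an isomorphism on `U`, and two morphisms out of `j_! N` that agree on `U` are
equal; so `i` is an epimorphism. -/
lemma supportedIn_extZero (U : Opens X) (N : ModOn A U) {W : Opens X}
    (s : ((extZero A U).obj N).val.presheaf.obj (op W)) : SupportedIn U s := by
  let i := supportedSubsheafι U ((extZero A U).obj N)
  have : Epi i := ⟨fun q q' h => by
    apply ((extZeroAdj A U).homEquiv _ _).injective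
    have h' : (resTo A U).map i ≫ (resTo A U).map q = (resTo A U).map i ≫ (resTo A U).map q' := by
      rw [← Functor.map_comp, ← Functor.map_comp, h]
    rw [cancel_epi] at h'
    rw [Adjunction.homEquiv_unit, Adjunction.homEquiv_unit, h']⟩
  have : IsIso i := isIso_of_mono_of_epi i
  obtain ⟨t, rfl⟩ := (bijective_sections_of_isIso i (op W)).2 s
  exact t.2

lemma SupportedIn.of_mono {U : Opens X} {M N : Mod A} (f : M ⟶ N) [Mono f] {W : Opens X}
    {s : M.val.presheaf.obj (op W)}
    (hs : SupportedIn (P := N) U (((PresheafOfModules.toPresheaf _).map f.val).app (op W) s)) :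
    SupportedIn U s := by
  intro x hx hxU
  obtain ⟨V, hV, hxV, h⟩ := hs x hx hxU
  refine ⟨V, hV, hxV, injective_sections_of_mono f (op V) ?_⟩
  erw [← NatTrans.naturality_apply] at h
  exact h.trans (map_zero (f.val.app (op V)).hom).symm

lemma isZero_resTo_iff (P : Mod A) (V : Opens X) : IsZero ((resTo A V).obj P) ↔
    ∀ W ≤ V, ∀ s : P.val.presheaf.obj (op W), s = 0 := by
  rw [isZero_iff_sections]
  exact ⟨fun h W hW s => h (op (Over.mk (homOfLE hW))) s,
    fun h W s => h _ (leOfHom W.unop.hom) s⟩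

/-- If all sections of `P` are supported in `U`, then `P` vanishes on `V` as soon as it vanishes on
`U ⊓ V`: a section over a subset of `V` is zero near all points, inside `U` as well as outside. -/
lemma isZero_resTo_of_supportedIn (U V : Opens X) (P : Mod A)
    (hP : ∀ (W : Opens X) (s : P.val.presheaf.obj (op W)), SupportedIn U s)
    (h : IsZero ((resTo A (U ⊓ V)).obj P)) : IsZero ((resTo A V).obj P) := by
  rw [isZero_resTo_iff] at h ⊢
  intro W hW s
  have (x : W) : ∃ (V' : Opens X) (hV' : V' ≤ W), x.1 ∈ V' ∧
      P.val.presheaf.map (homOfLE hV').op s = 0 := by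
    by_cases hx : x.1 ∈ U
    · exact ⟨U ⊓ W, inf_le_right, ⟨hx, x.2⟩, h _ (inf_le_inf_left _ hW) _⟩
    · exact hP W s x.1 x.2 hx
  choose V' hV' hx h0 using this
  refine (abSheaf P).eq_of_locally_eq' V' W (fun x => homOfLE (hV' x))
    (fun x hx' => Opens.mem_iSup.2 ⟨⟨x, hx'⟩, hx _⟩) s 0 fun x => ?_
  exact (h0 x).trans (map_zero _).symm

/-- The kernel of `j_! (M|_U) ⟶ M` vanishes on `U`, and its sections are supported in `U`. -/
instance (U : Opens X) (M : Mod A) : Mono ((extZeroAdj A U).counit.app M) := by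
  apply Preadditive.mono_of_isZero_kernel
  have h1 : IsZero ((resTo A U).obj (kernel ((extZeroAdj A U).counit.app M))) := by
    have : IsIso ((resTo A U).map ((extZeroAdj A U).counit.app M)) := inferInstance
    refine IsZero.of_iso ?_ (PreservesKernel.iso (resTo A U) _)
    exact isZero_kernel_of_mono _
  have h2 := isZero_resTo_of_supportedIn U ⊤ _ (fun W s => SupportedIn.of_mono (kernel.ι _)
    (supportedIn_extZero U _ _)) (by rwa [inf_top_eq])
  rw [isZero_resTo_iff] at h2
  rw [isZero_iff_sections]
  exact fun W s => h2 W.unop le_top s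

/-- A monomorphism `f` of sheaves on `U` is the restriction of the monomorphism `j_* f`, and
`j_! (M|_U)` is a subsheaf of `M`, naturally in `M`. -/
instance (U : Opens X) : (extZero A U).PreservesMonomorphisms where
  preserves {K N} f hf := by
    let e := asIso (directImageAdj A U).counit
    have : Mono ((extZero A U).map ((resTo A U).map ((directImage A U).map f))) := by
      have : (extZero A U).map ((resTo A U).map ((directImage A U).map f)) ≫
        (extZeroAdj A U).counit.app _ =
          (extZeroAdj A U).counit.app ((directImage A U).obj K) ≫ (directImage A U).map f :=
        (extZeroAdj A U).counit.naturality _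
      have h2 : Mono ((extZeroAdj A U).counit.app ((directImage A U).obj K) ≫
          (directImage A U).map f) :=
        have : (directImage A U).IsRightAdjoint := (directImageAdj A U).isRightAdjoint
        inferInstance
      rw [← this] at h2
      exact @mono_of_mono _ _ _ _ _ _ _ h2
    have h3 : (extZero A U).map f = (extZero A U).map (e.inv.app K) ≫
      (extZero A U).map ((resTo A U).map ((directImage A U).map f)) ≫
        (extZero A U).map (e.hom.app N) := by
      rw [← Functor.map_comp, ← Functor.map_comp]
      congr 1
      have := e.hom.naturality f
      simp only [Functor.comp_map, Functor.id_map] at this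
      rw [this]; simp
    rw [h3]
    infer_instance

instance (U : Opens X) : PreservesFiniteLimits (extZero A U) := by
  rw [(extZero A U).preservesFiniteLimits_iff_forall_exact_map_and_mono]
  intro S hS
  have := hS.mono_f
  exact ⟨((extZero A U).preservesFiniteColimits_iff_forall_exact_map_and_epi.1 inferInstance
    S hS).1, inferInstance⟩
end

/-! ### Local nature of morphisms of sheaves of modules -/

section
open Opposite
variable {X : Type u} [TopologicalSpace X] {A : Sheaf (Opens.grothendieckTopology X) RingCat.{u}}

lemma isZero_resTo_of_le {U V : Opens X} (h : V ≤ U) (P : Mod A)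
    (hP : IsZero ((resTo A U).obj P)) : IsZero ((resTo A V).obj P) := by
  rw [isZero_resTo_iff] at hP ⊢
  exact fun W hW s => hP W (hW.trans h) s

lemma isZero_resTo_of_cover {ι : Type*} (V : ι → Opens X) {W : Opens X} (hW : W ≤ iSup V)
    (P : Mod A) (hP : ∀ i, IsZero ((resTo A (V i)).obj P)) : IsZero ((resTo A W).obj P) := by
  simp only [isZero_resTo_iff] at hP ⊢
  intro Y hY s
  refine (abSheaf P).eq_of_locally_eq' (fun i => Y ⊓ V i) Y (fun i => homOfLE inf_le_left)
    (by rw [← inf_iSup_eq]; exact le_inf le_rfl (hY.trans hW)) s 0 fun i => ?_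
  rw [map_zero]
  exact hP i _ inf_le_right _

lemma isZero_of_cover {ι : Type*} {W : Opens X} (V : ι → Opens X) (hVW : ∀ i, V i ≤ W)
    (hW : W ≤ iSup V) (K : ModOn A W) (hK : ∀ i, IsZero ((res A (hVW i)).obj K)) : IsZero K := by
  let e := asIso ((directImageAdj A W).counit.app K)
  refine IsZero.of_iso (isZero_resTo_of_cover V hW _ fun i => ?_) e.symm
  exact (hK i).of_iso (((SheafOfModules.overFunctorMap A (homOfLE (hVW i))).app _).symm ≪≫
    (res A (hVW i)).mapIso e)

/-- The map induced by `g : P|_V ⟶ Q|_V` on the sections over an open subset `Y ≤ V`. -/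
noncomputable def sectionsMap {V : Opens X} {P Q : Mod A}
    (g : (resTo A V).obj P ⟶ (resTo A V).obj Q)
    {Y : Opens X} (hY : Y ≤ V) : P.val.presheaf.obj (op Y) →+ Q.val.presheaf.obj (op Y) :=
  (((PresheafOfModules.toPresheaf _).map g.val).app (op (Over.mk (homOfLE hY)))).hom

lemma sectionsMap_naturality {V : Opens X} {P Q : Mod A} (g : (resTo A V).obj P ⟶ (resTo A V).obj Q)
    {Y Y' : Opens X} (hY : Y ≤ V) (f : Y' ⟶ Y) (s : P.val.presheaf.obj (op Y)) :
    Q.val.presheaf.map f.op (sectionsMap g hY s) =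
      sectionsMap g (f.le.trans hY) (P.val.presheaf.map f.op s) :=
  (NatTrans.naturality_apply ((PresheafOfModules.toPresheaf _).map g.val)
    (Over.homMk (U := Over.mk (homOfLE (f.le.trans hY))) (V := Over.mk (homOfLE hY)) f).op s).symm

lemma sectionsMap_smul {V : Opens X} {P Q : Mod A} (g : (resTo A V).obj P ⟶ (resTo A V).obj Q)
    {Y : Opens X} (hY : Y ≤ V) (r : A.obj.obj (op Y)) (s : P.val.obj (op Y)) :
    sectionsMap g hY (r • s : P.val.obj (op Y)) =
      (r • (show Q.val.obj (op Y) from sectionsMap g hY s) : Q.val.obj (op Y)) :=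
  (g.val.app (op (Over.mk (homOfLE hY)))).hom.map_smul r s

/-- Morphisms `P|_{V i} ⟶ Q|_{V i}` that agree on overlaps glue. The sheaves `P` and `Q` are
defined on the whole space so that their sections are sections of sheaves on `X`. -/
lemma exists_glue_hom {ι : Type*} (V : ι → Opens X) {W : Opens X} (hVW : ∀ i, V i ≤ W)
    (hW : W ≤ iSup V) (P Q : Mod A) (g : ∀ i, (resTo A (V i)).obj P ⟶ (resTo A (V i)).obj Q)
    (hg : ∀ i j Y (hi : Y ≤ V i) (hj : Y ≤ V j) s,
      sectionsMap (g i) hi s = sectionsMap (g j) hj s) :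
    ∃ f : (resTo A W).obj P ⟶ (resTo A W).obj Q,
      ∀ i Y (hi : Y ≤ V i) s, sectionsMap f (hi.trans (hVW i)) s = sectionsMap (g i) hi s := by
  have key (Y : Opens X) (hY : Y ≤ W) (s : P.val.presheaf.obj (op Y)) :
      ∃! t : Q.val.presheaf.obj (op Y), ∀ i,
        Q.val.presheaf.map (homOfLE (inf_le_left : Y ⊓ V i ≤ Y)).op t =
        sectionsMap (g i) inf_le_right
          (P.val.presheaf.map (homOfLE (inf_le_left : Y ⊓ V i ≤ Y)).op s) := by
    refine (abSheaf Q).existsUnique_gluing' (fun i => Y ⊓ V i) Y (fun i => homOfLE inf_le_left)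
      (by rw [← inf_iSup_eq]; exact le_inf le_rfl (hY.trans hW)) _ ?_
    intro i j
    refine (sectionsMap_naturality _ _ _ _).trans
      ((hg i j _ _ (inf_le_right.trans inf_le_right) _).trans
        (Eq.trans ?_ (sectionsMap_naturality _ _ _ _).symm))
    congr 1
    rw [restrict_restrict P _ _ (homOfLE (inf_le_left.trans inf_le_left)), restrict_restrict]
  choose t ht hu using key
  have hadd {Y : Opens X} (hY : Y ≤ W) (s s') : t Y hY (s + s') = t Y hY s + t Y hY s' :=
    (hu Y hY _ _ fun i => by simp only [map_add, ht]).symm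
  have hsmul {Y : Opens X} (hY : Y ≤ W) (r : A.obj.obj (op Y)) (s : P.val.obj (op Y)) :
      t Y hY (r • s : P.val.obj (op Y)) =
        (r • (show Q.val.obj (op Y) from t Y hY s) : Q.val.obj (op Y)) := by
    refine (hu Y hY _ _ fun i => ?_).symm
    refine (Q.val.map_smul _ r _).trans (Eq.trans ?_
      (congrArg (sectionsMap (g i) _) (P.val.map_smul _ r s).symm))
    refine Eq.trans ?_ (sectionsMap_smul (g i) inf_le_right _ _).symm
    exact congrArg (_ • ·) (ht Y hY s i)
  have hnat {Y Y' : Opens X} (hY : Y ≤ W) (f : Y' ⟶ Y) (s) :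
      Q.val.presheaf.map f.op (t Y hY s) = t Y' (f.le.trans hY) (P.val.presheaf.map f.op s) := by
    refine hu _ _ _ _ fun i => ?_
    rw [restrict_restrict Q _ _ (homOfLE (inf_le_left.trans f.le)),
      restrict_restrict P _ _ (homOfLE (inf_le_left.trans f.le)),
      ← restrict_restrict Q (homOfLE (inf_le_left : Y ⊓ V i ≤ Y))
        (homOfLE (inf_le_inf_right _ f.le)), ht,
      sectionsMap_naturality, restrict_restrict P _ _ (homOfLE (inf_le_left.trans f.le))]
  let φ : ((resTo A W).obj P).val.presheaf ⟶ ((resTo A W).obj Q).val.presheaf :=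
    { app Y := AddCommGrpCat.ofHom (AddMonoidHom.mk' (t Y.unop.left (leOfHom Y.unop.hom)) (hadd _))
      naturality Y Y' f := by
        ext s
        exact (hnat _ f.unop.left s).symm }
  refine ⟨⟨PresheafOfModules.homMk φ fun Y r s => hsmul (leOfHom Y.unop.hom) r s⟩, ?_⟩
  intro i Y hi s
  refine (hu _ _ _ _ fun j => ?_).symm
  rw [sectionsMap_naturality]
  exact hg _ _ _ _ _ _
end

/-! ### Local nature of membership in a thick abelian substack -/

section
open Opposite
variable {X : Type u} [TopologicalSpace X] {A : Sheaf (Opens.grothendieckTopology X) RingCat.{u}}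

lemma isIso_of_cover {ι : Type*} {W : Opens X} (V : ι → Opens X) (hVW : ∀ i, V i ≤ W)
    (hW : W ≤ iSup V) {K L : ModOn A W} (f : K ⟶ L) (hf : ∀ i, IsIso ((res A (hVW i)).map f)) :
    IsIso f := by
  have : Mono f := Preadditive.mono_of_isZero_kernel _ <| isZero_of_cover V hVW hW _ fun i =>
    (isZero_kernel_of_mono ((res A (hVW i)).map f)).of_iso (PreservesKernel.iso (res A (hVW i)) _)
  have : Epi f := Preadditive.epi_of_isZero_cokernel _ <| isZero_of_cover V hVW hW _ fun i =>
    (isZero_cokernel_of_epi ((res A (hVW i)).map f)).of_iso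
      (PreservesCokernel.iso (res A (hVW i)) _)
  exact isIso_of_mono_of_epi f

/-- Membership in a thick abelian substack is local. The descent data defined by `Q` are effective
in the substack, and the object `N` so obtained is isomorphic to `Q|_W` since morphisms of sheaves
glue. -/
theorem ThickAbelianSubstack.mem_of_cover (C : ThickAbelianSubstack A) {ι : Type u} {W : Opens X}
    (V : ι → Opens X) (hVW : ∀ i, V i ≤ W)
    (hW : W = iSup V) (Q : Mod A) (hQ : ∀ i, C.mem (V i) ((resTo A (V i)).obj Q)) :
    C.mem W ((resTo A W).obj Q) := by
  obtain ⟨N, hN, ψ, hψ⟩ := C.descent_obj V hVW hW (fun i => (resTo A (V i)).obj Q) hQ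
    (fun i j => (SheafOfModules.overFunctorMap A (homOfLE _)).app Q ≪≫
      ((SheafOfModules.overFunctorMap A (homOfLE _)).app Q).symm)
    (fun i j k => rfl)
  -- `N` is the restriction to `W` of the sheaf `P`, as `exists_glue_hom` requires
  let e := asIso ((directImageAdj A W).counit.app N)
  let P := (directImage A W).obj N
  let g (i) : (resTo A (V i)).obj P ⟶ (resTo A (V i)).obj Q :=
    (SheafOfModules.overFunctorMap A (homOfLE (hVW i))).inv.app P ≫
      (res A (hVW i)).map e.hom ≫ (ψ i).hom
  obtain ⟨f, hf⟩ := exists_glue_hom V hVW hW.le P Q g (fun i j Y hi hj s =>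
    congrArg (fun F => F.val.app (op (Over.mk (homOfLE (le_inf hi hj))))
      (e.hom.val.app (op (Over.mk (homOfLE (hi.trans (hVW i))))) s)) (hψ i j))
  have : IsIso f := by
    refine isIso_of_cover V hVW hW.le f fun i => ?_
    have : (res A (hVW i)).map f =
        (SheafOfModules.overFunctorMap A (homOfLE (hVW i))).hom.app P ≫ g i ≫
        (SheafOfModules.overFunctorMap A (homOfLE (hVW i))).inv.app Q := by
      ext Y s
      exact hf i Y.unop.left (leOfHom Y.unop.hom) s
    rw [this]
    infer_instance
  exact (C.mem W).prop_of_iso (e.symm ≪≫ asIso f) hN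
end

/-! ### Restriction and extension by zero on derived categories -/

section

variable {E : Type*} [Category* E] [Abelian E] {E' : Type*} [Category* E'] [Abelian E']
  {F : E ⥤ E'} {G : E' ⥤ E} [F.Additive] [G.Additive]

/-- The adjunction between categories of complexes induced by an adjunction of additive functors. -/
def mapHomologicalComplexAdj (adj : F ⊣ G) {ι : Type*} (c : ComplexShape ι) :
    F.mapHomologicalComplex c ⊣ G.mapHomologicalComplex c where
  unit :=
    { app K :=
        { f i := adj.unit.app (K.X i)
          comm' i j _ := (adj.unit.naturality (K.d i j)).symm }
      naturality K L f := by
        ext i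
        exact adj.unit.naturality (f.f i) }
  counit :=
    { app K :=
        { f i := adj.counit.app (K.X i)
          comm' i j _ := (adj.counit.naturality (K.d i j)).symm }
      naturality K L f := by
        ext i
        exact adj.counit.naturality (f.f i) }
  left_triangle_components K := by
    ext i
    exact adj.left_triangle_components (K.X i)
  right_triangle_components K := by
    ext i
    exact adj.right_triangle_components (K.X i)

variable [PreservesFiniteLimits F] [PreservesFiniteColimits F]
  [PreservesFiniteLimits G] [PreservesFiniteColimits G]
  [HasDerivedCategory.{w} E] [HasDerivedCategory.{w'} E']

noncomputable instance (F : E ⥤ E') [F.Additive] [PreservesFiniteLimits F]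
    [PreservesFiniteColimits F] :
  CatCommSq (F.mapHomologicalComplex (ComplexShape.up ℤ)) DerivedCategory.Q DerivedCategory.Q
    F.mapDerivedCategory := ⟨F.mapDerivedCategoryFactors.symm⟩

/-- The adjunction between derived categories induced by an adjunction of exact functors. -/
noncomputable def mapDerivedCategoryAdj (adj : F ⊣ G) :
    F.mapDerivedCategory ⊣ G.mapDerivedCategory :=
  (mapHomologicalComplexAdj adj (ComplexShape.up ℤ)).localization
    DerivedCategory.Q (HomologicalComplex.quasiIso E (ComplexShape.up ℤ))
    DerivedCategory.Q (HomologicalComplex.quasiIso E' (ComplexShape.up ℤ)) _ _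

instance (adj : F ⊣ G) [IsIso adj.unit] : IsIso (mapDerivedCategoryAdj adj).unit := by
  rw [NatTrans.isIso_iff_isIso_app]
  intro K
  let e := DerivedCategory.Q.objObjPreimageIso K
  rw [← NatTrans.isIso_app_iff_of_iso _ e]
  have (K : CochainComplex E ℤ) :
      IsIso ((mapHomologicalComplexAdj adj (ComplexShape.up ℤ)).unit.app K) := by
    have (i : ℤ) : IsIso (((mapHomologicalComplexAdj adj (ComplexShape.up ℤ)).unit.app K).f i) :=
      inferInstanceAs (IsIso (adj.unit.app (K.X i)))
    exact HomologicalComplex.Hom.isIso_of_components _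
  dsimp only [mapDerivedCategoryAdj]
  rw [Adjunction.localization_unit_app]
  infer_instance

lemma isZero_iff_homology (K : DerivedCategory E) :
    IsZero K ↔ ∀ n, IsZero ((DerivedCategory.homologyFunctor E n).obj K) := by
  refine ⟨fun h n => Functor.map_isZero _ h, fun h => ?_⟩
  have : IsIso (0 : K ⟶ 0) := by
    rw [DerivedCategory.isIso_iff]
    intro n
    exact ⟨0, (h n).eq_of_src _ _, (Functor.map_isZero _ (isZero_zero _)).eq_of_src _ _⟩
  exact (isZero_zero _).of_iso (asIso (0 : K ⟶ 0))

lemma isZero_mapDerivedCategory_iff (F : E ⥤ E') [F.Additive] [PreservesFiniteLimits F]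
    [PreservesFiniteColimits F] (K : DerivedCategory E) :
    IsZero (F.mapDerivedCategory.obj K) ↔
      ∀ n, IsZero (F.obj ((DerivedCategory.homologyFunctor E n).obj K)) := by
  rw [isZero_iff_homology]
  exact forall_congr' fun n => (nonempty_homology_mapDerivedCategory_iso F n K).some.isZero_iff
end

section
variable {X : Type u} [TopologicalSpace X] (A : Sheaf (Opens.grothendieckTopology X) RingCat.{u})

/-- The restriction to `U` on derived categories. -/
noncomputable abbrev rD (U : Opens X) : DerivedCategory (Mod A) ⥤ DerivedCategory (ModOn A U) :=
  (resTo A U).mapDerivedCategory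

/-- The extension by zero from `U` on derived categories. -/
noncomputable abbrev lD (U : Opens X) : DerivedCategory (ModOn A U) ⥤ DerivedCategory (Mod A) :=
  (extZero A U).mapDerivedCategory

/-- The adjunction between extension by zero and restriction on derived categories. -/
noncomputable abbrev adjD (U : Opens X) : lD A U ⊣ rD A U := mapDerivedCategoryAdj (extZeroAdj A U)

instance (U : Opens X) : IsIso (adjD A U).unit := inferInstance

variable {A}
lemma isZero_rD_of_le {U V : Opens X} (h : V ≤ U) (K : DerivedCategory (Mod A))
    (hK : IsZero ((rD A U).obj K)) : IsZero ((rD A V).obj K) := by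
  rw [isZero_mapDerivedCategory_iff] at hK ⊢
  exact fun n => isZero_resTo_of_le h _ (hK n)

lemma isZero_rD_of_cover {ι : Type*} (V : ι → Opens X) {W : Opens X} (hW : W ≤ iSup V)
    (K : DerivedCategory (Mod A))
    (hK : ∀ i, IsZero ((rD A (V i)).obj K)) : IsZero ((rD A W).obj K) := by
  simp only [isZero_mapDerivedCategory_iff] at hK ⊢
  exact fun n => isZero_resTo_of_cover V hW _ (fun i => hK i n)

/-- The cohomology of `j_! (K|_U)` is a subsheaf of that of `K`, and is supported in `U`. -/
lemma isZero_rD_lD_rD {U V : Opens X} (K : DerivedCategory (Mod A))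
    (hK : IsZero ((rD A (U ⊓ V)).obj K)) :
    IsZero ((rD A V).obj ((lD A U).obj ((rD A U).obj K))) := by
  rw [isZero_mapDerivedCategory_iff] at hK ⊢
  intro n
  obtain ⟨e₁⟩ := nonempty_homology_mapDerivedCategory_iso (extZero A U) n ((rD A U).obj K)
  obtain ⟨e₂⟩ := nonempty_homology_mapDerivedCategory_iso (resTo A U) n K
  refine IsZero.of_iso ?_ ((resTo A V).mapIso (e₁ ≪≫ (extZero A U).mapIso e₂))
  refine isZero_resTo_of_supportedIn U V _ (fun W s => supportedIn_extZero U _ s) ?_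
  rw [isZero_resTo_iff]
  intro W hW s
  apply injective_sections_of_mono ((extZeroAdj A U).counit.app _)
  exact ((isZero_resTo_iff _ _).1 (hK n) W hW _).trans ((isZero_resTo_iff _ _).1 (hK n) W hW _).symm

lemma isIso_map_iff_isZero_cone {D D' : Type*} [Category* D] [Category* D']
    [Preadditive D] [HasZeroObject D]
    [HasShift D ℤ] [∀ n : ℤ, (shiftFunctor D n).Additive] [Pretriangulated D]
    [Preadditive D'] [HasZeroObject D']
    [HasShift D' ℤ] [∀ n : ℤ, (shiftFunctor D' n).Additive] [Pretriangulated D']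
    (F : D ⥤ D') [F.CommShift ℤ] [F.IsTriangulated]
    {K L M : D} {f : K ⟶ L} {g : L ⟶ M} {h : M ⟶ K⟦(1 : ℤ)⟧}
    (hT : Triangle.mk f g h ∈ distTriang D) :
    IsIso (F.map f) ↔ IsZero (F.obj M) :=
  (Triangle.isZero₃_iff_isIso₁ _ (F.map_distinguished _ hT)).symm

lemma isIso_rD_of_le {U V : Opens X} (h : V ≤ U) {K L : DerivedCategory (Mod A)} (f : K ⟶ L)
    (hf : IsIso ((rD A U).map f)) : IsIso ((rD A V).map f) := by
  obtain ⟨_, g, h', hT⟩ := distinguished_cocone_triangle f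
  rw [isIso_map_iff_isZero_cone _ hT] at hf
  exact (isIso_map_iff_isZero_cone _ hT).2 (isZero_rD_of_le h _ hf)

lemma isIso_rD_of_cover {ι : Type*} (V : ι → Opens X) {W : Opens X} (hW : W ≤ iSup V)
    {K L : DerivedCategory (Mod A)} (f : K ⟶ L)
    (hf : ∀ i, IsIso ((rD A (V i)).map f)) : IsIso ((rD A W).map f) := by
  obtain ⟨_, g, h', hT⟩ := distinguished_cocone_triangle f
  simp only [fun i => isIso_map_iff_isZero_cone (rD A (V i)) hT] at hf
  exact (isIso_map_iff_isZero_cone _ hT).2 (isZero_rD_of_cover V hW _ hf)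

lemma isIso_rD_lD_rD {U V : Opens X} {K L : DerivedCategory (Mod A)} (f : K ⟶ L)
    (hf : IsIso ((rD A (U ⊓ V)).map f)) :
    IsIso ((rD A V).map ((lD A U).map ((rD A U).map f))) := by
  obtain ⟨_, g, h', hT⟩ := distinguished_cocone_triangle f
  rw [isIso_map_iff_isZero_cone _ hT] at hf
  exact (isIso_map_iff_isZero_cone (rD A U ⋙ lD A U ⋙ rD A V) hT).2 (isZero_rD_lD_rD _ hf)
end

/-! ### Cones, weak pushouts and gluing of objects -/

section
variable {D : Type*} [Category* D] [Preadditive D] [HasZeroObject D]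
    [HasShift D ℤ] [∀ n : ℤ, (shiftFunctor D n).Additive] [Pretriangulated D]

section
variable {K L M Z : D} {f : K ⟶ L} {g : L ⟶ M} {h : M ⟶ K⟦(1 : ℤ)⟧}
  (hT : Triangle.mk f g h ∈ distTriang D)
include hT

lemma exists_lift_of_comp_eq_zero (x : Z ⟶ L) (hx : x ≫ g = 0) : ∃ y : Z ⟶ K, y ≫ f = x :=
  (Triangle.coyoneda_exact₂ _ hT x hx).imp fun _ h => h.symm

lemma exists_lift_of_comp_eq_zero' (x : Z ⟶ M) (hx : x ≫ h = 0) : ∃ y : Z ⟶ L, y ≫ g = x :=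
  (Triangle.coyoneda_exact₃ _ hT x hx).imp fun _ h => h.symm

lemma exists_desc_of_comp_eq_zero (x : L ⟶ Z) (hx : f ≫ x = 0) : ∃ y : M ⟶ Z, g ≫ y = x :=
  (Triangle.yoneda_exact₂ _ hT x hx).imp fun _ h => h.symm

lemma exists_desc_of_comp_eq_zero' (x : M ⟶ Z) (hx : g ≫ x = 0) :
    ∃ y : K⟦(1 : ℤ)⟧ ⟶ Z, h ≫ y = x :=
  (Triangle.yoneda_exact₃ _ hT x hx).imp fun _ h => h.symm

lemma eq_zero_of_comp_eq_zero (hZ : ∀ g : Z⟦(1 : ℤ)⟧ ⟶ M, g = 0)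
    (x : Z ⟶ K) (hx : x ≫ f = 0) : x = 0 := by
  obtain ⟨y, hy⟩ : ∃ y : Z⟦(1 : ℤ)⟧ ⟶ M, x⟦(1 : ℤ)⟧' = y ≫ h :=
    Triangle.coyoneda_exact₁ _ hT (x⟦(1 : ℤ)⟧')
    (show x⟦(1 : ℤ)⟧' ≫ f⟦(1 : ℤ)⟧' = 0 by rw [← Functor.map_comp, hx, Functor.map_zero])
  rw [hZ y, zero_comp] at hy
  exact (shiftFunctor D (1 : ℤ)).map_injective (hy.trans (Functor.map_zero _ _ _).symm)
end

/-- Let `S` be the biproduct of `K₁` and `K₂`, and `C` the cone of a morphism `K ⟶ S` whose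
component `K ⟶ K₂` is an isomorphism. Then `K₁ ⟶ C` is an isomorphism. -/
lemma isIso_inl_comp_of_isIso_comp_snd {K S C K₁ K₂ : D} {f : K ⟶ S} {g : S ⟶ C}
    {h : C ⟶ K⟦(1 : ℤ)⟧}
    (hT : Triangle.mk f g h ∈ distTriang D) {i₁ : K₁ ⟶ S} {p₁ : S ⟶ K₁} {i₂ : K₂ ⟶ S} {p₂ : S ⟶ K₂}
    (h₁ : i₁ ≫ p₁ = 𝟙 _) (h₁₂ : i₁ ≫ p₂ = 0)
    (hsum : p₁ ≫ i₁ + p₂ ≫ i₂ = 𝟙 _) (hf : IsIso (f ≫ p₂)) : IsIso (i₁ ≫ g) := by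
  have hfg : f ≫ g = 0 := comp_distTriang_mor_zero₁₂ _ hT
  have hh : h = 0 := by
    have h0 : h ≫ f⟦(1 : ℤ)⟧' = 0 := comp_distTriang_mor_zero₃₁ _ hT
    have : h ≫ (f ≫ p₂)⟦(1 : ℤ)⟧' = 0 := by rw [Functor.map_comp, reassoc_of% h0, zero_comp]
    rwa [Preadditive.IsIso.comp_right_eq_zero] at this
  refine isIso_of_yoneda_map_bijective _ fun Z => ⟨fun x y hxy => ?_, fun z => ?_⟩
  · obtain ⟨w, hw⟩ := exists_lift_of_comp_eq_zero hT ((x - y) ≫ i₁) (by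
      dsimp only at hxy
      rw [Category.assoc, Preadditive.sub_comp, hxy, sub_self])
    have : w ≫ f ≫ p₂ = 0 := by rw [← Category.assoc, hw, Category.assoc, h₁₂, comp_zero]
    rw [Preadditive.IsIso.comp_right_eq_zero] at this
    rw [this, zero_comp] at hw
    rw [← sub_eq_zero, ← Category.comp_id (x - y), ← h₁, ← Category.assoc, ← hw, zero_comp]
  · obtain ⟨w, hw⟩ := exists_lift_of_comp_eq_zero' hT z (by rw [hh, comp_zero])
    refine ⟨(w - w ≫ p₂ ≫ inv (f ≫ p₂) ≫ f) ≫ p₁, ?_⟩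
    have : (w - w ≫ p₂ ≫ inv (f ≫ p₂) ≫ f) ≫ p₂ = 0 := by simp
    have h2 : (w - w ≫ p₂ ≫ inv (f ≫ p₂) ≫ f) ≫ p₁ ≫ i₁ = w - w ≫ p₂ ≫ inv (f ≫ p₂) ≫ f := by
      conv_rhs => rw [← Category.comp_id (w - _), ← hsum]
      rw [Preadditive.comp_add, reassoc_of% this, zero_comp, add_zero]
    dsimp only
    rw [Category.assoc, reassoc_of% h2, Preadditive.sub_comp, hw]
    simp [hfg]

/-- A weak pushout of `a` and `b`: the cone of `(a, -b) : K ⟶ K₁ ⊞ K₂`. -/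
lemma exists_weak_pushout {K K₁ K₂ : D} (a : K ⟶ K₁) (b : K ⟶ K₂) :
    ∃ (C : D) (j₁ : K₁ ⟶ C) (j₂ : K₂ ⟶ C) (δ : C ⟶ K⟦(1 : ℤ)⟧),
      Triangle.mk (biprod.lift a (-b)) (biprod.desc j₁ j₂) δ ∈ distTriang D := by
  obtain ⟨C, g, δ, h⟩ := distinguished_cocone_triangle (biprod.lift a (-b))
  refine ⟨C, biprod.inl ≫ g, biprod.inr ≫ g, δ, ?_⟩
  convert h
  ext <;> simp

section
variable {D' : Type*} [Category* D'] [Preadditive D'] [HasZeroObject D']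
    [HasShift D' ℤ] [∀ n : ℤ, (shiftFunctor D' n).Additive] [Pretriangulated D']
    (F : D ⥤ D') [F.CommShift ℤ] [F.IsTriangulated]
    {K K₁ K₂ C : D} {a : K ⟶ K₁} {b : K ⟶ K₂} {j₁ : K₁ ⟶ C} {j₂ : K₂ ⟶ C} {δ : C ⟶ K⟦(1 : ℤ)⟧}
    (hT : Triangle.mk (biprod.lift a (-b)) (biprod.desc j₁ j₂) δ ∈ distTriang D)
include hT

lemma isIso_map_inl_of_weak_pushout (hb : IsIso (F.map b)) : IsIso (F.map j₁) := by
  have hF : Triangle.mk (F.map (biprod.lift a (-b))) (F.map (biprod.desc j₁ j₂))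
    (F.map δ ≫ (F.commShiftIso (1 : ℤ)).hom.app K) ∈ distTriang D' := F.map_distinguished _ hT
  have := isIso_inl_comp_of_isIso_comp_snd hF
    (i₁ := F.map biprod.inl) (p₁ := F.map biprod.fst)
    (i₂ := F.map biprod.inr) (p₂ := F.map biprod.snd)
    (by simp [← F.map_comp]) (by simp [← F.map_comp])
    (by rw [← F.map_comp, ← F.map_comp, ← F.map_add, biprod.total, F.map_id])
    (by rw [← F.map_comp, biprod.lift_snd, F.map_neg]
        exact ⟨-inv (F.map b), by simp, by simp⟩)
  rwa [← F.map_comp, biprod.inl_desc] at this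

lemma isIso_map_inr_of_weak_pushout (ha : IsIso (F.map a)) : IsIso (F.map j₂) := by
  have hF : Triangle.mk (F.map (biprod.lift a (-b))) (F.map (biprod.desc j₁ j₂))
    (F.map δ ≫ (F.commShiftIso (1 : ℤ)).hom.app K) ∈ distTriang D' := F.map_distinguished _ hT
  have := isIso_inl_comp_of_isIso_comp_snd hF
    (i₁ := F.map biprod.inr) (p₁ := F.map biprod.snd)
    (i₂ := F.map biprod.inl) (p₂ := F.map biprod.fst)
    (by simp [← F.map_comp]) (by simp [← F.map_comp])
    (by rw [← F.map_comp, ← F.map_comp, ← F.map_add, add_comm, biprod.total, F.map_id])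
    (by rw [← F.map_comp, biprod.lift_fst]; infer_instance)
  rwa [← F.map_comp, biprod.inr_desc] at this
end

/-- A morphism between two truncations `X₁` and `X₂` of `M` over `M` is an isomorphism. The
inverse `γ` is the lift of `X₂ ⟶ M` to `X₁`, and lifts are unique since `Hom(X[1], Y)` vanishes.
-/
lemma isIso_of_truncations {X₁ X₂ M Y₁ Y₂ : D}
    {m₁ : X₁ ⟶ M} {n₁ : M ⟶ Y₁} {δ₁ : Y₁ ⟶ X₁⟦(1 : ℤ)⟧}
    (hT₁ : Triangle.mk m₁ n₁ δ₁ ∈ distTriang D)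
    {m₂ : X₂ ⟶ M} {n₂ : M ⟶ Y₂} {δ₂ : Y₂ ⟶ X₂⟦(1 : ℤ)⟧}
    (hT₂ : Triangle.mk m₂ n₂ δ₂ ∈ distTriang D)
    (h₁₁ : ∀ g : X₁⟦(1 : ℤ)⟧ ⟶ Y₁, g = 0) (h₂₂ : ∀ g : X₂⟦(1 : ℤ)⟧ ⟶ Y₂, g = 0)
    (h₂₁ : ∀ g : X₂ ⟶ Y₁, g = 0) (β : X₁ ⟶ X₂) (hβ : β ≫ m₂ = m₁) : IsIso β := by
  obtain ⟨γ, hγ⟩ := exists_lift_of_comp_eq_zero hT₁ m₂ (h₂₁ _)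
  refine ⟨γ, sub_eq_zero.1 (eq_zero_of_comp_eq_zero hT₁ h₁₁ _ ?_),
    sub_eq_zero.1 (eq_zero_of_comp_eq_zero hT₂ h₂₂ _ ?_)⟩
  · simp [Preadditive.sub_comp, hγ, hβ]
  · simp [Preadditive.sub_comp, hγ, hβ]
end

section
variable {X : Type u} [TopologicalSpace X] {A : Sheaf (Opens.grothendieckTopology X) RingCat.{u}}

/-- The endofunctor `M ↦ j_! (M|_U)` of the derived category of sheaves of modules on `X`. -/
noncomputable abbrev cutoff (A : Sheaf (Opens.grothendieckTopology X) RingCat.{u}) (U : Opens X) :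
  DerivedCategory (Mod A) ⥤ DerivedCategory (Mod A) :=
  rD A U ⋙ lD A U

/-- The canonical morphism `j_! (K|_U) ⟶ K`. -/
noncomputable abbrev cutoffι (U : Opens X) (K : DerivedCategory (Mod A)) : (cutoff A U).obj K ⟶ K :=
  (adjD A U).counit.app K

instance isIso_rD_cutoffι (U : Opens X) (K : DerivedCategory (Mod A)) :
    IsIso ((rD A U).map (cutoffι U K)) := by
  have h := (adjD A U).right_triangle_components K
  have : (rD A U).map (cutoffι U K) = inv ((adjD A U).unit.app _) := by
    rw [IsIso.eq_inv_of_hom_inv_id h]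
  rw [this]
  infer_instance

lemma isIso_rD_cutoffι_of_le {U V : Opens X} (h : V ≤ U) (K : DerivedCategory (Mod A)) :
    IsIso ((rD A V).map (cutoffι U K)) := isIso_rD_of_le h _ inferInstance

/-- A morphism that is an isomorphism on `U` induces bijections on morphisms out of `j_! (K|_U)`. -/
lemma cutoff_comp_bijective (U : Opens X) (K : DerivedCategory (Mod A))
    {L L' : DerivedCategory (Mod A)}
    (g : L ⟶ L') (hg : IsIso ((rD A U).map g)) :
    Function.Bijective (fun f : (cutoff A U).obj K ⟶ L => f ≫ g) := by
  have : (fun f : (cutoff A U).obj K ⟶ L => f ≫ g) =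
    ((adjD A U).homEquiv _ _).symm ∘ (fun f => f ≫ (rD A U).map g) ∘ ((adjD A U).homEquiv _ _) := by
    ext f
    simp [Adjunction.homEquiv_naturality_right_symm]
  rw [this]
  exact (Equiv.bijective _).comp
    (((asIso ((rD A U).map g)).homToEquiv).bijective.comp (Equiv.bijective _))

lemma isIso_cutoffι_cutoff {U W : Opens X} (h : W ≤ U) (K : DerivedCategory (Mod A)) :
    IsIso (cutoffι U ((cutoff A W).obj K)) := by
  obtain ⟨τ, hτ⟩ := (cutoff_comp_bijective W K (cutoffι U ((cutoff A W).obj K))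
    (isIso_rD_cutoffι_of_le h _)).2 (𝟙 _)
  dsimp only at hτ
  refine ⟨τ, (cutoff_comp_bijective U _ (cutoffι U ((cutoff A W).obj K)) inferInstance).1 ?_, hτ⟩
  dsimp only
  rw [Category.assoc, hτ, Category.id_comp, Category.comp_id]

/-- Let `a` be a morphism of objects supported in `U`, in the sense that `j_! (K|_U) ⟶ K` is an
isomorphism. If `a` is an isomorphism on `U ⊓ V`, then it is one on `V`. -/
lemma isIso_rD_of_isIso_cutoffι {U V : Opens X} {K L : DerivedCategory (Mod A)} (a : K ⟶ L)
    (hK : IsIso (cutoffι U K)) (hL : IsIso (cutoffι U L)) (ha : IsIso ((rD A (U ⊓ V)).map a)) :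
    IsIso ((rD A V).map a) := by
  have h : (cutoff A U).map a ≫ cutoffι U L = cutoffι U K ≫ a := (adjD A U).counit.naturality a
  have h2 : IsIso ((rD A V).map ((cutoff A U).map a)) := isIso_rD_lD_rD a ha
  have : a = inv (cutoffι U K) ≫ (cutoff A U).map a ≫ cutoffι U L := by simp
  rw [this, Functor.map_comp, Functor.map_comp]
  infer_instance

/-- All morphisms from `M` to `N` on the open subset `W` are zero. -/
def HomVanishes (W : Opens X) (M N : DerivedCategory (Mod A)) : Prop :=
  ∀ g : (rD A W).obj M ⟶ (rD A W).obj N, g = 0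

lemma HomVanishes.cutoff_eq_zero {W : Opens X} {M N : DerivedCategory (Mod A)}
    (h : HomVanishes W M N)
    (f : (cutoff A W).obj M ⟶ N) : f = 0 := by
  apply ((adjD A W).homEquiv _ _).injective
  rw [h ((adjD A W).homEquiv _ _ f), h ((adjD A W).homEquiv _ _ 0)]

lemma HomVanishes.of_cutoff_eq_zero {W : Opens X} {M N : DerivedCategory (Mod A)}
    (h : ∀ f : (cutoff A W).obj M ⟶ N, f = 0) : HomVanishes W M N := fun g => by
  apply ((adjD A W).homEquiv _ _).symm.injective
  rw [h (((adjD A W).homEquiv _ _).symm g), h (((adjD A W).homEquiv _ _).symm 0)]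

/-- Gluing of `M₁` on `W₁` and `M₂` on `W₂` along a morphism `β` that is an isomorphism on `W₁ ⊓
W₂`. The result `C` is a weak pushout of the cutoffs of `M₁` and `M₂`; it is not unique, but it
restricts to `M₁` and `M₂`, it receives compatible pairs of morphisms, and morphisms out of `C`
are determined by their restrictions along `j₁` and `j₂` if `Hom(M₁[1], N)` vanishes on `W₁ ⊓ W₂`.
The last assertion allows one to control finiteness conditions on `C`. -/
lemma exists_glued {W₁ W₂ : Opens X} (M₁ M₂ : DerivedCategory (Mod A))
    (β : (cutoff A (W₁ ⊓ W₂)).obj M₁ ⟶ M₂) (hβ : IsIso ((rD A (W₁ ⊓ W₂)).map β)) :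
    ∃ (C : DerivedCategory (Mod A)) (j₁ : (cutoff A W₁).obj M₁ ⟶ C) (j₂ : (cutoff A W₂).obj M₂ ⟶ C),
      IsIso ((rD A W₁).map j₁) ∧ IsIso ((rD A W₂).map j₂) ∧
      (∀ (T : DerivedCategory (Mod A)) (t₁ : M₁ ⟶ T) (t₂ : M₂ ⟶ T), cutoffι _ M₁ ≫ t₁ = β ≫ t₂ →
        ∃ φ : C ⟶ T, j₁ ≫ φ = cutoffι W₁ M₁ ≫ t₁ ∧ j₂ ≫ φ = cutoffι W₂ M₂ ≫ t₂) ∧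
      (∀ (N : DerivedCategory (Mod A)), HomVanishes (W₁ ⊓ W₂) (M₁⟦(1 : ℤ)⟧) N → ∀ f : C ⟶ N,
        j₁ ≫ f = 0 → j₂ ≫ f = 0 → f = 0) ∧
      (∀ P : ObjectProperty (DerivedCategory (Mod A)), P.IsTriangulated →
        P.IsClosedUnderIsomorphisms → P ((cutoff A (W₁ ⊓ W₂)).obj M₁) →
        P ((cutoff A W₁).obj M₁) → P ((cutoff A W₂).obj M₂) → P C) := by
  obtain ⟨a, ha⟩ := (cutoff_comp_bijective (W₁ ⊓ W₂) M₁ (cutoffι W₁ M₁)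
    (isIso_rD_cutoffι_of_le inf_le_left _)).2 (cutoffι _ M₁)
  obtain ⟨b, hb⟩ := (cutoff_comp_bijective (W₁ ⊓ W₂) M₁ (cutoffι W₂ M₂)
    (isIso_rD_cutoffι_of_le inf_le_right _)).2 β
  dsimp only at ha hb
  have ha' : IsIso ((rD A (W₁ ⊓ W₂)).map a) := by
    have := isIso_rD_cutoffι_of_le (inf_le_left : W₁ ⊓ W₂ ≤ _) M₁
    have h2 : IsIso ((rD A (W₁ ⊓ W₂)).map (a ≫ cutoffι W₁ M₁)) := by rw [ha]; infer_instance
    rw [Functor.map_comp] at h2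
    exact IsIso.of_isIso_comp_right _ ((rD A (W₁ ⊓ W₂)).map (cutoffι W₁ M₁))
  have hb' : IsIso ((rD A (W₁ ⊓ W₂)).map b) := by
    have := isIso_rD_cutoffι_of_le (inf_le_right : W₁ ⊓ W₂ ≤ _) M₂
    have h2 : IsIso ((rD A (W₁ ⊓ W₂)).map (b ≫ cutoffι W₂ M₂)) := by rw [hb]; infer_instance
    rw [Functor.map_comp] at h2
    exact IsIso.of_isIso_comp_right _ ((rD A (W₁ ⊓ W₂)).map (cutoffι W₂ M₂))
  have ha2 : IsIso ((rD A W₂).map a) := isIso_rD_of_isIso_cutoffι (U := W₁) a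
    (isIso_cutoffι_cutoff inf_le_left _) (isIso_cutoffι_cutoff le_rfl _) ha'
  have hb1 : IsIso ((rD A W₁).map b) := isIso_rD_of_isIso_cutoffι (U := W₂) b
    (isIso_cutoffι_cutoff inf_le_right _) (isIso_cutoffι_cutoff le_rfl _)
    (isIso_rD_of_le (le_inf inf_le_right inf_le_left) _ hb')
  obtain ⟨C, j₁, j₂, δ, hT⟩ := exists_weak_pushout a b
  refine ⟨C, j₁, j₂, isIso_map_inl_of_weak_pushout (rD A W₁) hT hb1,
    isIso_map_inr_of_weak_pushout (rD A W₂) hT ha2, ?_, ?_, ?_⟩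
  · intro T t₁ t₂ h
    obtain ⟨φ, hφ⟩ := exists_desc_of_comp_eq_zero hT
      (biprod.desc (cutoffι W₁ M₁ ≫ t₁) (cutoffι W₂ M₂ ≫ t₂)) (by
        rw [biprod.lift_desc, Preadditive.neg_comp,
          reassoc_of% ha, reassoc_of% hb, h, add_neg_cancel])
    refine ⟨φ, ?_, ?_⟩
    · simpa using congrArg (biprod.inl ≫ ·) hφ
    · simpa using congrArg (biprod.inr ≫ ·) hφ
  · intro N hN f h₁ h₂
    obtain ⟨y, hy⟩ := exists_desc_of_comp_eq_zero' hT f (by ext <;> simp [h₁, h₂])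
    have hy0 : y = 0 := by
      have := hN.cutoff_eq_zero (((cutoff A (W₁ ⊓ W₂)).commShiftIso (1 : ℤ)).hom.app M₁ ≫ y)
      rwa [Preadditive.IsIso.comp_left_eq_zero] at this
    rw [← hy, hy0, comp_zero]
  · intro P _ _ h h₁ h₂
    have : P ((cutoff A W₁).obj M₁ ⊞ (cutoff A W₂).obj M₂) :=
      P.ext_of_isTriangulatedClosed₂ _ (binaryBiproductTriangle_distinguished _ _) h₁ h₂
    exact P.ext_of_isTriangulatedClosed₃ _ hT h this
end

/-! ### Mayer-Vietoris for vanishing of morphisms, and gluing of triangles -/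

lemma isIso_map_shift {D D' : Type*} [Category* D] [HasShift D ℤ] [Category* D'] [HasShift D' ℤ]
    (F : D ⥤ D') [F.CommShift ℤ] {K L : D} (f : K ⟶ L) (n : ℤ) (hf : IsIso (F.map f)) :
    IsIso (F.map (f⟦n⟧')) :=
  (NatIso.isIso_map_iff (F.commShiftIso n) f).2
    (inferInstanceAs (IsIso ((shiftFunctor D' n).map (F.map f))))

section
variable {D D' : Type*} [Category* D] [Preadditive D] [HasZeroObject D]
    [HasShift D ℤ] [∀ n : ℤ, (shiftFunctor D n).Additive] [Pretriangulated D]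
    [Category* D'] [Preadditive D'] [HasZeroObject D']
    [HasShift D' ℤ] [∀ n : ℤ, (shiftFunctor D' n).Additive] [Pretriangulated D']
    (F : D ⥤ D') [F.CommShift ℤ]

lemma nonempty_iso_of_distinguished {K K' L M M' : D} {f : K ⟶ L} {g : L ⟶ M} {h : M ⟶ K⟦(1 : ℤ)⟧}
    (hT : Triangle.mk f g h ∈ distTriang D) {f' : K' ⟶ L} {g' : L ⟶ M'} {h' : M' ⟶ K'⟦(1 : ℤ)⟧}
    (hT' : Triangle.mk f' g' h' ∈ distTriang D) (e : K ≅ K') (he : e.hom ≫ f' = f) :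
    Nonempty (M ≅ M') :=
  ⟨Triangle.π₃.mapIso (isoTriangleOfIso₁₂ _ _ hT hT' e (Iso.refl _)
    (show f ≫ 𝟙 _ = e.hom ≫ f' by rw [he, Category.comp_id]))⟩

variable [F.IsTriangulated] in
lemma map_mk_distinguished {K L M : D} {f : K ⟶ L} {g : L ⟶ M} {h : M ⟶ K⟦(1 : ℤ)⟧}
    (hT : Triangle.mk f g h ∈ distTriang D) :
    Triangle.mk (F.map f) (F.map g) (F.map h ≫ (F.commShiftIso (1 : ℤ)).hom.app K) ∈
      distTriang D' :=
  F.map_distinguished _ hT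

end

section
variable {X : Type u} [TopologicalSpace X] {A : Sheaf (Opens.grothendieckTopology X) RingCat.{u}}

lemma HomVanishes.of_isIso {W : Opens X} {M M' N : DerivedCategory (Mod A)} (h : HomVanishes W M' N)
    (f : M ⟶ M') (hf : IsIso ((rD A W).map f)) : HomVanishes W M N := fun g => by
  have := h (inv ((rD A W).map f) ≫ g)
  rwa [Preadditive.IsIso.comp_left_eq_zero] at this

lemma HomVanishes.shift {W : Opens X} {M N : DerivedCategory (Mod A)} {n : ℤ}
    (h : HomVanishes W (M⟦n⟧) N)
    (g : ((rD A W).obj M)⟦n⟧ ⟶ (rD A W).obj N) : g = 0 := by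
  have := h (((rD A W).commShiftIso n).hom.app M ≫ g)
  rwa [Preadditive.IsIso.comp_left_eq_zero] at this

/-- The part `H^{-1}(U ⊓ V) ⟶ H^0(U ⊔ V) ⟶ H^0(U) ⊕ H^0(V)` of the Mayer-Vietoris sequence of
`RHom(M, N)`, stated as a vanishing result. The cutoff `K` of `M` to `U ⊔ V` is glued with itself;
the result is isomorphic to `K` on `U ⊔ V`, which makes `φ` a split epimorphism. -/
theorem HomVanishes.sup {U V : Opens X} {M N : DerivedCategory (Mod A)} (hU : HomVanishes U M N)
    (hV : HomVanishes V M N) (hUV : HomVanishes (U ⊓ V) (M⟦(1 : ℤ)⟧) N) :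
    HomVanishes (U ⊔ V) M N := by
  refine .of_cutoff_eq_zero fun f => ?_
  let K := (cutoff A (U ⊔ V)).obj M
  let c : K ⟶ M := cutoffι (U ⊔ V) M
  obtain ⟨C, j₁, j₂, hj₁, hj₂, hφ, hC, -⟩ :=
    exists_glued (W₁ := U) (W₂ := V) K K (cutoffι _ K) inferInstance
  obtain ⟨φ, h₁, h₂⟩ := hφ K (𝟙 _) (𝟙 _) rfl
  have hφU : IsIso ((rD A U).map φ) := by
    have : IsIso ((rD A U).map (j₁ ≫ φ)) := by rw [h₁, Category.comp_id]; infer_instance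
    rw [Functor.map_comp] at this
    exact IsIso.of_isIso_comp_left ((rD A U).map j₁) _
  have hφV : IsIso ((rD A V).map φ) := by
    have : IsIso ((rD A V).map (j₂ ≫ φ)) := by rw [h₂, Category.comp_id]; infer_instance
    rw [Functor.map_comp] at this
    exact IsIso.of_isIso_comp_left ((rD A V).map j₂) _
  have hφW : IsIso ((rD A (U ⊔ V)).map φ) :=
    isIso_rD_of_cover (fun b : Bool => cond b U V) (sup_eq_iSup U V).le φ
      (by rintro (_ | _) <;> assumption)
  -- a section of `φ`
  obtain ⟨σ, hσ⟩ := (cutoff_comp_bijective (U ⊔ V) M φ hφW).2 (𝟙 K)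
  have hf : φ ≫ f = 0 := by
    refine hC N (hUV.of_isIso (c⟦(1 : ℤ)⟧') (isIso_map_shift _ _ _
      (isIso_rD_cutoffι_of_le (inf_le_left.trans le_sup_left) M))) _ ?_ ?_
    · rw [reassoc_of% h₁]
      exact (hU.of_isIso c (isIso_rD_cutoffι_of_le le_sup_left M)).cutoff_eq_zero _
    · rw [reassoc_of% h₂]
      exact (hV.of_isIso c (isIso_rD_cutoffι_of_le le_sup_right M)).cutoff_eq_zero _
  dsimp only at hσ
  rw [← Category.id_comp f, ← hσ, Category.assoc, hf, comp_zero]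

/-- If `M₁ ⟶ M ⟶ Y₁` and `M₂ ⟶ M ⟶ Y₂` are triangles that behave like truncation triangles on
`W₁ ⊓ W₂`, then there is a triangle `M' ⟶ M ⟶ Y` that restricts to the first one on `W₁` and to the
second one on `W₂`. Properties that are stable under cones and under cutoffs pass from `M₁` and
`M₂` to `M'`. -/
theorem exists_glued_triangle {W₁ W₂ : Opens X} {M M₁ M₂ Y₁ Y₂ : DerivedCategory (Mod A)}
    {m₁ : M₁ ⟶ M} {n₁ : M ⟶ Y₁} {δ₁ : Y₁ ⟶ M₁⟦(1 : ℤ)⟧}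
    (hT₁ : Triangle.mk m₁ n₁ δ₁ ∈ distTriang _)
    {m₂ : M₂ ⟶ M} {n₂ : M ⟶ Y₂} {δ₂ : Y₂ ⟶ M₂⟦(1 : ℤ)⟧}
    (hT₂ : Triangle.mk m₂ n₂ δ₂ ∈ distTriang _)
    (h₁₁ : HomVanishes (W₁ ⊓ W₂) (M₁⟦(1 : ℤ)⟧) Y₁) (h₂₂ : HomVanishes (W₁ ⊓ W₂) (M₂⟦(1 : ℤ)⟧) Y₂)
    (h₂₁ : HomVanishes (W₁ ⊓ W₂) M₂ Y₁) (h₁₂ : HomVanishes (W₁ ⊓ W₂) M₁ Y₂) :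
    ∃ (M' Y : DerivedCategory (Mod A)) (m : M' ⟶ M) (n : M ⟶ Y) (δ : Y ⟶ M'⟦(1 : ℤ)⟧),
      Triangle.mk m n δ ∈ distTriang _ ∧
      Nonempty ((rD A W₁).obj M₁ ≅ (rD A W₁).obj M') ∧
      Nonempty ((rD A W₁).obj Y₁ ≅ (rD A W₁).obj Y) ∧
      Nonempty ((rD A W₂).obj M₂ ≅ (rD A W₂).obj M') ∧
      Nonempty ((rD A W₂).obj Y₂ ≅ (rD A W₂).obj Y) ∧
      (∀ P : ObjectProperty (DerivedCategory (Mod A)), P.IsTriangulated →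
        P.IsClosedUnderIsomorphisms → (∀ U K, P K → P ((cutoff A U).obj K)) →
        P M₁ → P M₂ → P M') := by
  obtain ⟨β, hβ⟩ := exists_lift_of_comp_eq_zero hT₂ (cutoffι (W₁ ⊓ W₂) M₁ ≫ m₁)
    (h₁₂.cutoff_eq_zero _)
  have hβ' : IsIso ((rD A (W₁ ⊓ W₂)).map β) := by
    have := isIso_of_truncations (map_mk_distinguished (rD A (W₁ ⊓ W₂)) hT₁)
      (map_mk_distinguished (rD A (W₁ ⊓ W₂)) hT₂) h₁₁.shift h₂₂.shift h₂₁
      (inv ((rD A (W₁ ⊓ W₂)).map (cutoffι _ M₁)) ≫ (rD A (W₁ ⊓ W₂)).map β) (by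
        rw [Category.assoc, ← Functor.map_comp, hβ]; simp)
    exact IsIso.of_isIso_comp_left (inv ((rD A (W₁ ⊓ W₂)).map (cutoffι _ M₁))) _
  obtain ⟨C, j₁, j₂, hj₁, hj₂, hφ, -, hP⟩ := exists_glued M₁ M₂ β hβ'
  obtain ⟨m, h₁, h₂⟩ := hφ M m₁ m₂ hβ.symm
  obtain ⟨Y, n, δ, hT⟩ := distinguished_cocone_triangle m
  let e₁ := (asIso ((rD A W₁).map (cutoffι W₁ M₁))).symm ≪≫ asIso ((rD A W₁).map j₁)
  let e₂ := (asIso ((rD A W₂).map (cutoffι W₂ M₂))).symm ≪≫ asIso ((rD A W₂).map j₂)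
  refine ⟨C, Y, m, n, δ, hT, ⟨e₁⟩,
    nonempty_iso_of_distinguished (map_mk_distinguished (rD A W₁) hT₁)
    (map_mk_distinguished (rD A W₁) hT) e₁ ?_, ⟨e₂⟩,
    nonempty_iso_of_distinguished (map_mk_distinguished (rD A W₂) hT₂)
    (map_mk_distinguished (rD A W₂) hT) e₂ ?_, fun P h h' hE hP₁ hP₂ =>
      hP P h h' (hE _ _ hP₁) (hE _ _ hP₁) (hE _ _ hP₂)⟩
  · simp [e₁, ← Functor.map_comp, h₁]
  · simp [e₂, ← Functor.map_comp, h₂]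
end

/-! ### Local properties of the restrictions of a bounded complex -/

section
variable {E : Type*} [Category* E] [Abelian E] [HasDerivedCategory.{w} E]
  {E' : Type*} [Category* E'] [Abelian E'] [HasDerivedCategory.{w'} E']
  (F : E ⥤ E') [F.Additive] [PreservesFiniteLimits F] [PreservesFiniteColimits F]

instance (P : ObjectProperty E) [IsThickAbelian P] :
    (boundedCohomologyIn P).IsClosedUnderIsomorphisms := by
  dsimp [boundedCohomologyIn]
  infer_instance

lemma isLE_mapDerivedCategory (K : DerivedCategory E) (n : ℤ) [hK : K.IsLE n] :
    (F.mapDerivedCategory.obj K).IsLE n := by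
  rw [DerivedCategory.isLE_iff] at hK ⊢
  exact fun i hi => (F.map_isZero (hK i hi)).of_iso
    (nonempty_homology_mapDerivedCategory_iso F i K).some

lemma isGE_mapDerivedCategory (K : DerivedCategory E) (n : ℤ) [hK : K.IsGE n] :
    (F.mapDerivedCategory.obj K).IsGE n := by
  rw [DerivedCategory.isGE_iff] at hK ⊢
  exact fun i hi => (F.map_isZero (hK i hi)).of_iso
    (nonempty_homology_mapDerivedCategory_iso F i K).some

lemma bounded_mapDerivedCategory (K : DerivedCategory E)
    (hK : (DerivedCategory.TStructure.t (C := E)).bounded K) :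
    (DerivedCategory.TStructure.t (C := E')).bounded (F.mapDerivedCategory.obj K) := by
  obtain ⟨⟨a, ha⟩, ⟨b, hb⟩⟩ := hK
  exact ⟨⟨a, isGE_mapDerivedCategory F K a⟩, ⟨b, isLE_mapDerivedCategory F K b⟩⟩
end

section
variable {X : Type u} [TopologicalSpace X] {A : Sheaf (Opens.grothendieckTopology X) RingCat.{u}}

lemma nonempty_res_mapDerivedCategory_iso {V U : Opens X} (h : V ≤ U)
    (K : DerivedCategory (Mod A)) :
    Nonempty ((res A h).mapDerivedCategory.obj ((rD A U).obj K) ≅ (rD A V).obj K) := by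
  let P := DerivedCategory.Q.objPreimage K
  let e : DerivedCategory.Q.obj P ≅ K := DerivedCategory.Q.objObjPreimageIso K
  let φ : ((res A h).mapHomologicalComplex (ComplexShape.up ℤ)).obj
      (((resTo A U).mapHomologicalComplex _).obj P) ≅ ((resTo A V).mapHomologicalComplex _).obj P :=
    HomologicalComplex.Hom.isoOfComponents
      (fun i => (SheafOfModules.overFunctorMap A (homOfLE h)).app (P.X i))
      (fun i j _ => ((SheafOfModules.overFunctorMap A (homOfLE h)).hom.naturality (P.d i j)).symm)
  exact ⟨(res A h).mapDerivedCategory.mapIso ((rD A U).mapIso e.symm ≪≫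
      (resTo A U).mapDerivedCategoryFactors.app P) ≪≫
    (res A h).mapDerivedCategoryFactors.app _ ≪≫
    DerivedCategory.Q.mapIso φ ≪≫
    ((resTo A V).mapDerivedCategoryFactors.app P).symm ≪≫ (rD A V).mapIso e⟩

lemma nonempty_rD_iso_of_le {V U : Opens X} (h : V ≤ U) {K L : DerivedCategory (Mod A)}
    (e : Nonempty ((rD A U).obj K ≅ (rD A U).obj L)) : Nonempty ((rD A V).obj K ≅ (rD A V).obj L) :=
  ⟨(nonempty_res_mapDerivedCategory_iso h K).some.symm ≪≫
    (res A h).mapDerivedCategory.mapIso e.some ≪≫ (nonempty_res_mapDerivedCategory_iso h L).some⟩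

lemma isIso_of_isIso_rD_top {K L : DerivedCategory (Mod A)} (f : K ⟶ L)
    (hf : IsIso ((rD A ⊤).map f)) : IsIso f := by
  obtain ⟨M, g, h', hT⟩ := distinguished_cocone_triangle f
  rw [isIso_map_iff_isZero_cone _ hT, isZero_mapDerivedCategory_iff] at hf
  refine (Triangle.isZero₃_iff_isIso₁ _ hT).1 ((isZero_iff_homology M).2 fun n => ?_)
  rw [isZero_iff_sections]
  exact fun W s => (isZero_resTo_iff _ _).1 (hf n) W.unop le_top s

variable {C : ThickAbelianSubstack A}

/-- The restriction of `K` to `U` belongs to `D^b_c(Mod A|_U)` and has the property `P`. The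
object `K` itself need not have cohomology in the substack. -/
def RestrictsTo {U : Opens X} (P : ObjectProperty (C.DbcOn U))
    (K : DerivedCategory (Mod A)) : Prop :=
  ∃ h : boundedCohomologyIn (C.mem U) ((rD A U).obj K), P ⟨_, h⟩

namespace RestrictsTo
variable {U : Opens X} {P : ObjectProperty (C.DbcOn U)} [P.IsClosedUnderIsomorphisms]

lemma of_iso {K L : DerivedCategory (Mod A)}
    (e : Nonempty ((rD A U).obj K ≅ (rD A U).obj L)) (hK : RestrictsTo P K) : RestrictsTo P L := by
  obtain ⟨h, hP⟩ := hK
  exact ⟨ObjectProperty.prop_of_iso _ e.some h, P.prop_of_iso (ObjectProperty.isoMk _ e.some) hP⟩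

lemma shift_iff (K : DerivedCategory (Mod A)) (n : ℤ) :
    RestrictsTo (P.shift n) K ↔ RestrictsTo P (K⟦n⟧) := by
  let e := ((rD A U).commShiftIso n).app K
  have e' (h) (h') : (⟨(rD A U).obj (K⟦n⟧), h'⟩ : C.DbcOn U) ≅
      (⟨(rD A U).obj K, h⟩ : C.DbcOn U)⟦n⟧ :=
    ObjectProperty.isoMk _ (e ≪≫
      ((boundedCohomologyIn (C.mem U)).ι.commShiftIso n).symm.app ⟨(rD A U).obj K, h⟩)
  have he : boundedCohomologyIn (C.mem U) ((rD A U).obj (K⟦n⟧)) ↔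
      boundedCohomologyIn (C.mem U) ((rD A U).obj K) :=
    (ObjectProperty.prop_iff_of_iso _ e).trans
      (ObjectProperty.prop_shift_iff_of_isStableUnderShift _ _ _)
  constructor
  · rintro ⟨h, hP⟩
    exact ⟨he.2 h, P.prop_of_iso (e' _ _).symm hP⟩
  · rintro ⟨h, hP⟩
    exact ⟨he.1 h, P.prop_of_iso (e' _ _) hP⟩
end RestrictsTo

lemma restrictsTo_dres_iff {U V : Opens X} (h : V ≤ U) {P : ObjectProperty (C.DbcOn V)}
    [P.IsClosedUnderIsomorphisms] {K : DerivedCategory (Mod A)}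
    (hK : boundedCohomologyIn (C.mem U) ((rD A U).obj K)) :
    P ((C.dres h).obj ⟨(rD A U).obj K, hK⟩) ↔ RestrictsTo P K := by
  obtain ⟨e⟩ := nonempty_res_mapDerivedCategory_iso h K
  constructor
  · intro hP
    have h' := ObjectProperty.prop_of_iso _ e ((C.dres h).obj ⟨(rD A U).obj K, hK⟩).property
    exact ⟨h', P.prop_of_iso (ObjectProperty.isoMk _ e) hP⟩
  · rintro ⟨h', hP⟩
    exact P.prop_of_iso (ObjectProperty.isoMk _ e.symm) hP

lemma cohomologyIn_of_cover {ι : Type u} {U : Opens X} (V : ι → Opens X) (hVU : ∀ i, V i ≤ U)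
    (hU : U = ⨆ i, V i)
    {K : DerivedCategory (Mod A)} (h : ∀ i, cohomologyIn (C.mem (V i)) ((rD A (V i)).obj K)) :
    cohomologyIn (C.mem U) ((rD A U).obj K) := fun n =>
  (C.mem U).prop_of_iso (nonempty_homology_mapDerivedCategory_iso (resTo A U) n K).some.symm
    (C.mem_of_cover V hVU hU _ fun i => (C.mem (V i)).prop_of_iso
      (nonempty_homology_mapDerivedCategory_iso (resTo A (V i)) n K).some (h i n))

section
variable {B : Set (Opens X)}

/-- A family of properties of the objects of `D^b_c(Mod A|_U)`, for `U ∈ B`, is local if for the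
restrictions of a bounded complex on `X` it can be tested on coverings by members of `B`. -/
def IsLocalFamily (P : ∀ U ∈ B, ObjectProperty (C.DbcOn U)) : Prop :=
  ∀ (U : Opens X) (hU : U ∈ B) {ι : Type u} (V : ι → Opens X) (hV : ∀ i, V i ∈ B),
    (∀ i, V i ≤ U) → U = ⨆ i, V i → ∀ K : DerivedCategory (Mod A),
    (DerivedCategory.TStructure.t (C := Mod A)).bounded K →
    (RestrictsTo (P U hU) K ↔ ∀ i, RestrictsTo (P (V i) (hV i)) K)

/-- The restrictions of `K` to the members of `B` contained in `W` have the property `P`. -/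
def RestrictsToOn (P : ∀ U ∈ B, ObjectProperty (C.DbcOn U)) (W : Opens X)
    (K : DerivedCategory (Mod A)) : Prop :=
  ∀ (U : Opens X) (hU : U ∈ B), U ≤ W → RestrictsTo (P U hU) K

variable {P : ∀ U ∈ B, ObjectProperty (C.DbcOn U)}

lemma isLocalFamily_of_iff [∀ U hU, (P U hU).IsClosedUnderIsomorphisms]
    (hP : ∀ (U : Opens X) (hU : U ∈ B) {ι : Type u} (V : ι → Opens X)
      (hV : ∀ i, V i ∈ B) (hVU : ∀ i, V i ≤ U) (_ : U = ⨆ i, V i) (M : C.DbcOn U),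
      P U hU M ↔ ∀ i, P (V i) (hV i) ((C.dres (hVU i)).obj M)) : IsLocalFamily P := by
  intro U hU ι V hV hVU hcov K hK
  constructor
  · rintro ⟨hK', h⟩ i
    exact (restrictsTo_dres_iff (hVU i) hK').1 ((hP U hU V hV hVU hcov _).1 h i)
  · intro h
    have hK' : boundedCohomologyIn (C.mem U) ((rD A U).obj K) :=
      ⟨bounded_mapDerivedCategory _ _ hK, cohomologyIn_of_cover V hVU hcov fun i => (h i).1.2⟩
    exact ⟨hK', (hP U hU V hV hVU hcov _).2 fun i => (restrictsTo_dres_iff _ _).2 (h i)⟩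

lemma IsLocalFamily.shift [∀ U hU, (P U hU).IsClosedUnderIsomorphisms]
    (hP : IsLocalFamily P) (n : ℤ) :
    IsLocalFamily (fun U hU => (P U hU).shift n) := by
  intro U hU ι V hV hVU hcov K hK
  simp only [RestrictsTo.shift_iff]
  exact hP U hU V hV hVU hcov _ (ObjectProperty.le_shift _ n _ hK)

lemma RestrictsToOn.mono {W W' : Opens X} {K : DerivedCategory (Mod A)}
    (hK : RestrictsToOn P W K) (h : W' ≤ W) : RestrictsToOn P W' K :=
  fun U hU hUW => hK U hU (hUW.trans h)

lemma RestrictsToOn.of_iso [∀ U hU, (P U hU).IsClosedUnderIsomorphisms]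
    {W : Opens X} {K L : DerivedCategory (Mod A)}
    (hK : RestrictsToOn P W K) (e : Nonempty ((rD A W).obj K ≅ (rD A W).obj L)) :
    RestrictsToOn P W L :=
  fun U hU hUW => (hK U hU hUW).of_iso (nonempty_rD_iso_of_le hUW e)

/-- A local property that holds on `U` holds on all members `V` of the basis contained in `U`,
because `U` is covered by `U` and `V`. -/
lemma IsLocalFamily.restrictsToOn (hP : IsLocalFamily P) {U : Opens X} {hU : U ∈ B}
    {K : DerivedCategory (Mod A)} (hb : (DerivedCategory.TStructure.t (C := Mod A)).bounded K)
    (hK : RestrictsTo (P U hU) K) : RestrictsToOn P U K := by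
  intro V hV hVU
  exact (hP U hU (fun b : ULift.{u} Bool => cond b.down U V) (by rintro ⟨_ | _⟩ <;> assumption)
    (by rintro ⟨_ | _⟩; exacts [hVU, le_rfl]) (le_antisymm (le_iSup_of_le ⟨true⟩ le_rfl)
      (iSup_le (by rintro ⟨_ | _⟩; exacts [hVU, le_rfl]))) K hb).1 hK ⟨false⟩

lemma IsLocalFamily.restrictsToOn_sup (hP : IsLocalFamily P) (hB : Opens.IsBasis B)
    {W₁ W₂ : Opens X} {K : DerivedCategory (Mod A)}
    (hb : (DerivedCategory.TStructure.t (C := Mod A)).bounded K)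
    (h₁ : RestrictsToOn P W₁ K) (h₂ : RestrictsToOn P W₂ K) : RestrictsToOn P (W₁ ⊔ W₂) K := by
  intro U hU hUW
  refine (hP U hU (fun V : {V : Opens X // V ∈ B ∧ V ≤ U ∧ (V ≤ W₁ ∨ V ≤ W₂)} => V.1)
    (fun V => V.2.1) (fun V => V.2.2.1) (le_antisymm ?_ (iSup_le fun V => V.2.2.1)) K hb).2
    fun V => V.2.2.2.elim (h₁ V.1 V.2.1) (h₂ V.1 V.2.1)
  intro x hx
  rw [Opens.mem_iSup]
  rcases hUW hx with h | h
  · obtain ⟨V, hV, hxV, hVU⟩ := Opens.isBasis_iff_nbhd.1 hB (U := U ⊓ W₁) ⟨hx, h⟩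
    exact ⟨⟨V, hV, hVU.trans inf_le_left, .inl (hVU.trans inf_le_right)⟩, hxV⟩
  · obtain ⟨V, hV, hxV, hVU⟩ := Opens.isBasis_iff_nbhd.1 hB (U := U ⊓ W₂) ⟨hx, h⟩
    exact ⟨⟨V, hV, hVU.trans inf_le_left, .inr (hVU.trans inf_le_right)⟩, hxV⟩

lemma RestrictsToOn.bot_of_isLocalFamily (hP : IsLocalFamily P) {K : DerivedCategory (Mod A)}
    (hb : (DerivedCategory.TStructure.t (C := Mod A)).bounded K) : RestrictsToOn P ⊥ K :=
  fun U hU hUW => (hP U hU (fun i : PEmpty => i.elim) (fun i => i.elim) (fun i => i.elim)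
    (le_antisymm (hUW.trans bot_le) (iSup_le fun i => i.elim)) K hb).2 fun i => i.elim
end
end

/-! ### The glued t-structure -/

/-- Distinguished triangles with vertices in a full triangulated subcategory lie in the
subcategory. -/
lemma mk_homMk_distinguished {D : Type*} [Category* D] [Preadditive D] [HasZeroObject D]
    [HasShift D ℤ] [∀ n : ℤ, (shiftFunctor D n).Additive] [Pretriangulated D]
    (P : ObjectProperty D) [P.IsTriangulated] {K L M : P.FullSubcategory} {f : K.obj ⟶ L.obj}
    {g : L.obj ⟶ M.obj} {h : M.obj ⟶ K.obj⟦(1 : ℤ)⟧} (hT : Triangle.mk f g h ∈ distTriang D) :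
    Triangle.mk (ObjectProperty.homMk f : K ⟶ L) (ObjectProperty.homMk g : L ⟶ M)
      (ObjectProperty.homMk (h ≫ (P.ι.commShiftIso (1 : ℤ)).inv.app K)) ∈
        distTriang P.FullSubcategory := by
  refine isomorphic_distinguished _ hT _ (Triangle.isoMk _ _ (Iso.refl K.obj) (Iso.refl L.obj)
    (Iso.refl M.obj) ((Category.comp_id f).trans (Category.id_comp f).symm)
    ((Category.comp_id g).trans (Category.id_comp g).symm) ?_)
  have comm {S : D} (e : S ≅ K.obj⟦(1 : ℤ)⟧) :
      ((h ≫ e.inv) ≫ e.hom) ≫ (𝟙 K.obj)⟦(1 : ℤ)⟧' = 𝟙 M.obj ≫ h := by simp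
  exact comm ((P.ι.commShiftIso (1 : ℤ)).app K)

section
variable {X : Type u} [TopologicalSpace X] {A : Sheaf (Opens.grothendieckTopology X) RingCat.{u}}
  {C : ThickAbelianSubstack A} {B : Set (Opens X)}

/-- On a noetherian space, a property of open subsets that holds for the empty set and for the
members of a basis, and that is stable under binary unions, holds for all open subsets. -/
lemma opens_induction_on_basis [NoetherianSpace X] (hB : Opens.IsBasis B) {p : Opens X → Prop}
    (bot : p ⊥) (basis : ∀ U ∈ B, p U) (union : ∀ U V, p U → p V → p (U ⊔ V)) (W : Opens X) :
    p W := by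
  obtain ⟨s, hs, rfl⟩ := Opens.isBasis_iff_cover.1 hB W
  obtain ⟨t, ht, h⟩ := CompleteLattice.WellFoundedGT.isSupFiniteCompact (Opens X) s
  rw [h]
  exact Finset.sup_induction bot (fun U hU V hV => union U V hU hV) fun U hU => basis U (hs (ht hU))

lemma homVanishes_bot (M N : DerivedCategory (Mod A)) : HomVanishes ⊥ M N := fun _ =>
  (isZero_rD_of_cover (fun i : PEmpty.{1} => i.elim) bot_le M fun i => i.elim).eq_of_src _ _

namespace ThickAbelianSubstack.LocalTStructures
variable (T : C.LocalTStructures B)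

lemma isLocalFamily_le : IsLocalFamily fun U hU => (T.t U hU).le 0 :=
  isLocalFamily_of_iff T.le_local

lemma isLocalFamily_ge_one : IsLocalFamily fun U hU => (T.t U hU).ge 1 := by
  have := (isLocalFamily_of_iff T.ge_local).shift 1
  simpa only [fun U hU => (T.t U hU).shift_ge 1 0 1 rfl] using this

lemma restrictsTo_le_shift {U : Opens X} {hU : U ∈ B} {K : DerivedCategory (Mod A)}
    (hK : RestrictsTo ((T.t U hU).le 0) K) (i : ℕ) :
    RestrictsTo ((T.t U hU).le 0) (K⟦(i : ℤ)⟧) := by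
  rw [← RestrictsTo.shift_iff, (T.t U hU).shift_le i 0 i (by simp)]
  exact ⟨hK.1, (T.t U hU).le_monotone (by lia) _ hK.2⟩

end ThickAbelianSubstack.LocalTStructures

variable (T : C.LocalTStructures B)

lemma homVanishes_of_restrictsTo {U : Opens X} {hU : U ∈ B} {M N : DerivedCategory (Mod A)}
    (hM : RestrictsTo ((T.t U hU).le 0) M) (hN : RestrictsTo ((T.t U hU).ge 1) N) :
    HomVanishes U M N := fun g =>
  congrArg (boundedCohomologyIn (C.mem U)).ι.map
    ((T.t U hU).zero' (ObjectProperty.homMk g : (⟨_, hM.1⟩ : C.DbcOn U) ⟶ ⟨_, hN.1⟩) hM.2 hN.2)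

lemma homVanishes_of_isLE_of_isGE (W : Opens X) {M N : DerivedCategory (Mod A)} {a b : ℤ}
    (h : b < a) (hM : M.IsLE b) (hN : N.IsGE a) : HomVanishes W M N := fun g =>
  DerivedCategory.TStructure.t.zero_of_isLE_of_isGE g b a h
    (isLE_mapDerivedCategory (resTo A W) M b)
    (isGE_mapDerivedCategory (resTo A W) N a)

/-- Objects that are locally `≤ 0` have no morphisms of nonpositive degree to objects that are
locally `≥ 1`. The statement for all shifts and all open subsets `V ≤ W` is proved simultaneously,
by descending induction on the shift and then by induction on `V`. -/
theorem homVanishes_shift_of_restrictsToOn [NoetherianSpace X] (hB : Opens.IsBasis B)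
    {W : Opens X} {M N : DerivedCategory (Mod A)}
    (hM : DerivedCategory.TStructure.t.bounded M) (hN : DerivedCategory.TStructure.t.bounded N)
    (hM' : RestrictsToOn (fun U hU => (T.t U hU).le 0) W M)
    (hN' : RestrictsToOn (fun U hU => (T.t U hU).ge 1) W N) (i : ℕ) :
    HomVanishes W (M⟦(i : ℤ)⟧) N := by
  obtain ⟨-, b, hb⟩ := hM
  obtain ⟨⟨a, ha⟩, -⟩ := hN
  -- `k` counts the shifts that are left until vanishing holds for degree reasons
  suffices ∀ (k i : ℕ), b - a < i + k → ∀ V ≤ W, HomVanishes V (M⟦(i : ℤ)⟧) N from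
    this (b - a + 1).toNat i (by lia) W le_rfl
  intro k
  induction k with
  | zero =>
    intro i hi V _
    exact homVanishes_of_isLE_of_isGE V (b := b - i) (by lia)
      (DerivedCategory.TStructure.t.isLE_shift M b i (b - i)) ha
  | succ k ih =>
    intro i hi V
    induction V using opens_induction_on_basis hB with
    | bot => exact fun _ => homVanishes_bot _ _
    | basis U hU =>
      exact fun h => homVanishes_of_restrictsTo T (hU := hU)
        (T.restrictsTo_le_shift (hM' U hU h) i) (hN' U hU h)
    | union U V hU hV =>
      intro h
      have e : M⟦(i : ℤ)⟧⟦(1 : ℤ)⟧ ≅ M⟦((i + 1 : ℕ) : ℤ)⟧ :=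
        ((shiftFunctorAdd' (DerivedCategory (Mod A)) (i : ℤ) 1 ((i + 1 : ℕ) : ℤ)
          (by simp)).app M).symm
      exact (hU (le_sup_left.trans h)).sup (hV (le_sup_right.trans h))
        ((ih (i + 1) (by push_cast; lia) _ (inf_le_left.trans (le_sup_left.trans h))).of_isIso
          e.hom inferInstance)

/-- There is a distinguished triangle `M' ⟶ M ⟶ Y` on `X`, with `M'` and `Y` bounded, that is a
truncation triangle of `M` locally on `W`. -/
def HasTruncationOn (W : Opens X) (M : DerivedCategory (Mod A)) : Prop :=
  ∃ (M' Y : DerivedCategory (Mod A)) (m : M' ⟶ M) (n : M ⟶ Y) (δ : Y ⟶ M'⟦(1 : ℤ)⟧),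
    Triangle.mk m n δ ∈ distTriang _ ∧ DerivedCategory.TStructure.t.bounded M' ∧
    DerivedCategory.TStructure.t.bounded Y ∧
    RestrictsToOn (fun U hU => (T.t U hU).le 0) W M' ∧
    RestrictsToOn (fun U hU => (T.t U hU).ge 1) W Y

variable {T}
lemma HasTruncationOn.sup [NoetherianSpace X] (hB : Opens.IsBasis B) {W₁ W₂ : Opens X}
    {M : DerivedCategory (Mod A)} (hM : DerivedCategory.TStructure.t.bounded M)
    (h₁ : HasTruncationOn T W₁ M) (h₂ : HasTruncationOn T W₂ M) :
    HasTruncationOn T (W₁ ⊔ W₂) M := by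
  obtain ⟨M₁, Y₁, m₁, n₁, δ₁, hT₁, hM₁, hY₁, hM₁', hY₁'⟩ := h₁
  obtain ⟨M₂, Y₂, m₂, n₂, δ₂, hT₂, hM₂, hY₂, hM₂', hY₂'⟩ := h₂
  have zero₁ {K L : DerivedCategory (Mod A)} (h : HomVanishes (W₁ ⊓ W₂) (K⟦((0 : ℕ) : ℤ)⟧) L) :
      HomVanishes (W₁ ⊓ W₂) K L :=
    h.of_isIso ((shiftFunctorZero (DerivedCategory (Mod A)) ℤ).inv.app K) inferInstance
  have hl := (inf_le_left : W₁ ⊓ W₂ ≤ W₁)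
  have hr := (inf_le_right : W₁ ⊓ W₂ ≤ W₂)
  obtain ⟨M', Y, m, n, δ, hT, e₁, f₁, e₂, f₂, hP⟩ := exists_glued_triangle hT₁ hT₂
    (homVanishes_shift_of_restrictsToOn T hB hM₁ hY₁ (hM₁'.mono hl) (hY₁'.mono hl) 1)
    (homVanishes_shift_of_restrictsToOn T hB hM₂ hY₂ (hM₂'.mono hr) (hY₂'.mono hr) 1)
    (zero₁ (homVanishes_shift_of_restrictsToOn T hB hM₂ hY₁ (hM₂'.mono hr) (hY₁'.mono hl) 0))
    (zero₁ (homVanishes_shift_of_restrictsToOn T hB hM₁ hY₂ (hM₁'.mono hl) (hY₂'.mono hr) 0))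
  have hM' : DerivedCategory.TStructure.t.bounded M' := hP _ inferInstance inferInstance
    (fun U K hK => bounded_mapDerivedCategory (extZero A U) _
      (bounded_mapDerivedCategory (resTo A U) _ hK)) hM₁ hM₂
  have hY := DerivedCategory.TStructure.t.bounded.ext_of_isTriangulatedClosed₃ _ hT hM' hM
  exact ⟨M', Y, m, n, δ, hT, hM', hY, T.isLocalFamily_le.restrictsToOn_sup hB hM'
    (hM₁'.of_iso e₁) (hM₂'.of_iso e₂), T.isLocalFamily_ge_one.restrictsToOn_sup hB hY
    (hY₁'.of_iso f₁) (hY₂'.of_iso f₂)⟩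

variable (T)
lemma hasTruncationOn_bot {M : DerivedCategory (Mod A)}
    (hM : DerivedCategory.TStructure.t.bounded M) :
    HasTruncationOn T ⊥ M :=
  have h0 : DerivedCategory.TStructure.t.bounded (0 : DerivedCategory (Mod A)) :=
    ObjectProperty.prop_zero _
  ⟨M, 0, 𝟙 M, 0, 0, contractible_distinguished M, hM, h0,
    .bot_of_isLocalFamily T.isLocalFamily_le hM, .bot_of_isLocalFamily T.isLocalFamily_ge_one h0⟩

lemma hasTruncationOn_basis {U : Opens X} (hU : U ∈ B) {M : DerivedCategory (Mod A)}
    (hM : DerivedCategory.TStructure.t.bounded M)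
    (hM' : boundedCohomologyIn (C.mem U) ((rD A U).obj M)) :
    HasTruncationOn T U M := by
  obtain ⟨K, L, hK, hL, f, g, h, hT⟩ := (T.t U hU).exists_triangle_zero_one ⟨_, hM'⟩
  have hT' := map_mk_distinguished (boundedCohomologyIn (C.mem U)).ι hT
  let m : (lD A U).obj K.obj ⟶ M := ((adjD A U).homEquiv _ _).symm f.hom
  obtain ⟨Y, n, δ, hmn⟩ := distinguished_cocone_triangle m
  have hb : DerivedCategory.TStructure.t.bounded ((lD A U).obj K.obj) :=
    bounded_mapDerivedCategory _ _ K.property.1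
  have hY := DerivedCategory.TStructure.t.bounded.ext_of_isTriangulatedClosed₃ _ hmn hb hM
  let e := asIso ((adjD A U).unit.app K.obj)
  have he : e.hom ≫ (rD A U).map m = f.hom := by
    rw [← ((adjD A U).homEquiv _ _).apply_symm_apply f.hom]
    exact ((adjD A U).homEquiv_unit ..).symm
  obtain ⟨e'⟩ := nonempty_iso_of_distinguished hT' (map_mk_distinguished (rD A U) hmn) e he
  refine ⟨_, Y, m, n, δ, hmn, hb, hY, T.isLocalFamily_le.restrictsToOn (hU := hU) hb ?_,
    T.isLocalFamily_ge_one.restrictsToOn (hU := hU) hY ?_⟩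
  · exact ⟨ObjectProperty.prop_of_iso _ e K.property, ObjectProperty.prop_of_iso _
      (ObjectProperty.isoMk _ e) hK⟩
  · exact ⟨ObjectProperty.prop_of_iso _ e' L.property, ObjectProperty.prop_of_iso _
      (ObjectProperty.isoMk _ e') hL⟩

theorem hasTruncationOn [NoetherianSpace X] (hB : Opens.IsBasis B) {M : DerivedCategory (Mod A)}
    (hM : boundedCohomologyIn C.global M) (W : Opens X) : HasTruncationOn T W M := by
  induction W using opens_induction_on_basis hB with
  | bot => exact hasTruncationOn_bot T hM.1
  | basis U hU =>
    exact hasTruncationOn_basis T hU hM.1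
      (boundedCohomologyIn_mapDerivedCategory (resTo A U) (C.mem_resTo U) M hM)
  | union U V hU hV => exact hU.sup hB hM.1 hV

lemma cohomologyIn_global_of_basis (hB : Opens.IsBasis B) {M : DerivedCategory (Mod A)}
    (hM : ∀ U ∈ B, cohomologyIn (C.mem U) ((rD A U).obj M)) : cohomologyIn C.global M := by
  have h : cohomologyIn (C.mem ⊤) ((rD A ⊤).obj M) :=
    cohomologyIn_of_cover (fun U : B => U.1) (fun _ => le_top)
      (by rw [← sSup_eq_iSup']; exact (eq_top_iff.2 fun x _ => by
        obtain ⟨V, hV, hxV, -⟩ := Opens.isBasis_iff_nbhd.1 hB (U := ⊤) (x := x) trivial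
        exact Opens.mem_sSup.2 ⟨V, hV, hxV⟩).symm) fun U => hM U.1 U.2
  exact fun n => (C.mem ⊤).prop_of_iso
    (nonempty_homology_mapDerivedCategory_iso (resTo A ⊤) n M).some (h n)

lemma boundedCohomologyIn_rD (M : C.Dbc) (U : Opens X) :
    boundedCohomologyIn (C.mem U) ((rD A U).obj M.obj) :=
  ((C.dresTo U).obj M).property

lemma prop_dresTo_shift {U : Opens X} (P : ObjectProperty (C.DbcOn U))
    [P.IsClosedUnderIsomorphisms] (M : C.Dbc) (a : ℤ) (h : P.shift a ((C.dresTo U).obj M)) :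
    P ((C.dresTo U).obj (M⟦a⟧)) := by
  obtain ⟨_, h⟩ := ((RestrictsTo.shift_iff M.obj a).1 ⟨boundedCohomologyIn_rD M U, h⟩).of_iso
    ⟨(rD A U).mapIso (((boundedCohomologyIn C.global).ι.commShiftIso a).symm.app M)⟩
  exact h

/-- The t-structure on `D^b_c(Mod A)` whose subcategories of objects `≤ n` and `≥ n` consist of the
objects all of whose restrictions to members of `B` are `≤ n` and `≥ n`. -/
def ThickAbelianSubstack.LocalTStructures.glued [NoetherianSpace X] (hB : Opens.IsBasis B) :
    TStructure C.Dbc where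
  le n M := ∀ U hU, (T.t U hU).le n ((C.dresTo U).obj M)
  ge n M := ∀ U hU, (T.t U hU).ge n ((C.dresTo U).obj M)
  le_isClosedUnderIsomorphisms n := ⟨fun e h U hU =>
    ObjectProperty.prop_of_iso _ ((C.dresTo U).mapIso e) (h U hU)⟩
  ge_isClosedUnderIsomorphisms n := ⟨fun e h U hU =>
    ObjectProperty.prop_of_iso _ ((C.dresTo U).mapIso e) (h U hU)⟩
  le_shift n a n' h M hM U hU := prop_dresTo_shift _ M a
    (by rw [(T.t U hU).shift_le a n' n h]; exact hM U hU)
  ge_shift n a n' h M hM U hU := prop_dresTo_shift _ M a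
    (by rw [(T.t U hU).shift_ge a n' n h]; exact hM U hU)
  zero' M N f hM hN := by
    have h := homVanishes_shift_of_restrictsToOn T hB (W := ⊤) M.property.1 N.property.1
      (fun U hU _ => ⟨boundedCohomologyIn_rD M U, hM U hU⟩)
      (fun U hU _ => ⟨boundedCohomologyIn_rD N U, hN U hU⟩) 0
    have h' := (h.of_isIso ((shiftFunctorZero (DerivedCategory (Mod A)) ℤ).inv.app M.obj)
      inferInstance).cutoff_eq_zero (cutoffι ⊤ M.obj ≫ f.hom)
    have := isIso_of_isIso_rD_top (cutoffι ⊤ M.obj) inferInstance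
    rw [Preadditive.IsIso.comp_left_eq_zero] at h'
    exact ObjectProperty.hom_ext _ h'
  le_zero_le M hM U hU := (T.t U hU).le_zero_le _ (hM U hU)
  ge_one_le M hM U hU := (T.t U hU).ge_one_le _ (hM U hU)
  exists_triangle_zero_one M := by
    obtain ⟨M', Y, m, n, δ, h, hM', -, h₁, h₂⟩ := hasTruncationOn T hB M.property ⊤
    have hM'' : boundedCohomologyIn C.global M' :=
      ⟨hM', cohomologyIn_global_of_basis hB fun U hU => (h₁ U hU le_top).1.2⟩
    have hY : boundedCohomologyIn C.global Y :=
      (boundedCohomologyIn C.global).ext_of_isTriangulatedClosed₃ _ h hM'' M.property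
    let K : C.Dbc := ⟨M', hM''⟩
    let L : C.Dbc := ⟨Y, hY⟩
    exact ⟨K, L, fun U hU => (h₁ U hU le_top).2, fun U hU => (h₂ U hU le_top).2, _, _, _,
      mk_homMk_distinguished (boundedCohomologyIn C.global) (K := K) (L := M) (M := L) h⟩

end

end GluingTStructures

theorem theorem4p10 {X : Type u} [TopologicalSpace X] [NoetherianSpace X]
    (A : Sheaf (Opens.grothendieckTopology X) RingCat.{u})
    (C : GluingTStructures.ThickAbelianSubstack A)
    (B : Set (Opens X)) (hB : Opens.IsBasis B)
    (T : C.LocalTStructures B) :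
    ∃ t : TStructure C.Dbc, t.le 0 = T.gluedLE ∧ t.ge 0 = T.gluedGE := by
  exact ⟨T.glued hB, rfl, rfl⟩
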